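/- **Setting.** Let $\Omega=(l_1,l_2)\times(l_3,l_4)$, let $\psi$ be continuous on $\Omega$, and put $\Gamma_I=\{\psi=0\}$, $\Omega^+=\{\psi>0\}$, $\Omega^-=\{\psi<0\}$ (subsets of $\Omega$). Let $a>0$ be of class $C^6$ in each of $\Omega^\pm$. Fix $p=(x^*,y^*)\in\Omega\setminus\Gamma_I$ and write $g^{(m,n)}=\partial_x^m\partial_y^n g(p)$. For $h>0$ the compact stencil centered at $p$ consists of the nine points $p+(kh,\ell h)$, $k,\ell\in\{-1,0,1\}$; $p$ is a *regular point* (for $h$) if $\psi\ge 0$ at all nine points or $\psi<0$ at all nine points. Let $\Lambda_K=\{(m,n)\in\mathbb N_0^2: m+n\le K\}$, $\Lambda^{V,1}_K=\{(m,n)\in\Lambda_K: m\le 1\}$, $\Lambda^{V,2}_K=\Lambda_K\setminus\Lambda^{V,1}_K$. Applying $\partial_x^{m}\partial_y^{n}$ to $a(u_{xx}+u_{yy})+a_xu_x+a_yu_y=-f$ at $p$ and solving for $u^{(m+2,n)}$ expresses recursively each $u^{(m',n')}$ with $m'\ge2$ as a linear combination of the $u^{(m,n)}$ with $m\le1$ and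 the $f^{(m,n)}$; let $A^{V,u}_{m',n',m,n}$ and $A^{V,f}_{m',n',m,n}$ be the coefficients of $u^{(m,n)}$ and of $f^{(m,n)}$ in it. With $M=6$ put $$G_{m,n}(x,y)=\sum_{\ell=0}^{\lfloor n/2\rfloor}\frac{(-1)^\ell x^{m+2\ell}y^{n-2\ell}}{(m+2\ell)!\,(n-2\ell)!}+\sum_{(m',n')\in\Lambda^{V,2}_{M+1}\setminus\Lambda^{V,2}_{m+n}}A^{V,u}_{m',n',m,n}\frac{x^{m'}y^{n'}}{m'!\,n'!},\qquad (m,n)\in\Lambda^{V,1}_{M+1},$$ $$Q_{m,n}(x,y)=\sum_{\ell=1}^{1+\lfloor n/2\rfloor}\frac{(-1)^\ell x^{m+2\ell}y^{n-2\ell+2}}{(m+2\ell)!\,(n-2\ell+2)!}\frac1{a^{(0,0)}}+\sum_{(m',n')\in\Lambda^{V,2}_{M+1}\setminus\Lambda^{V,2}_{m+n+2}}A^{V,f}_{m',n',m,n}\frac{x^{m'}y^{n'}}{m'!\,n'!},\qquad (m,n)\in\Lambda_{M-1}.$$ For real numbers $c_{k,\ell,i}$ let $C_{k,\ell}(h)=\sum_{i=0}^{7}c_{k,\ell,i}h^i$.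 The *order-matching linear system* for $\{c_{k,\ell,i}\}$ is $$\sum_{k=-1}^1\sum_{\ell=-1}^1 C_{k,\ell}(h)\,G_{m,n}(kh,\ell h)=\mathcal O(h^{8})\quad(h\to0^+)\qquad\text{for all }(m,n)\in\Lambda^{V,1}_{7},$$ and a solution is *nontrivial* if $C_{k,\ell}(0)\ne0$ for some $k,\ell$. Put $C_{f,m,n}(h)=\sum_{k,\ell}C_{k,\ell}(h)Q_{m,n}(kh,\ell h)$. **Theorem 2.1.** For all sufficiently small $h>0$ the stencil centered at $p$ lies in $\Omega$ and $p$ is a regular point. Moreover: 1. The order-matching system has a nontrivial solution. 2. For every nontrivial solution, the scheme $\mathcal L_hu_h:=\sum_{k,\ell}C_{k,\ell}(h)\,u_h(p+(kh,\ell h))=\sum_{(m,n)\in\Lambda_5}f^{(m,n)}C_{f,m,n}(h)$ is sixth-order consistent with $-\nabla\cdot(a\nabla u)=f$ at $p$: there is $\lambda\neq0$ such that for all $u,f$ with $u\in C^7(\Omega^\pm)$ with locally Lipschitz derivatives of order seven in $\Omega^\pm$ and $-\nabla\cdot(a\nabla u)=f$ in $\Omega\setminus\Gamma_I$, one has, as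 $h\to0^+$, $$h^{-2}\mathcal L_hu\to\lambda f(p)\qquad\text{and}\qquad \mathcal L_hu-\sum_{(m,n)\in\Lambda_5}f^{(m,n)}C_{f,m,n}(h)=\mathcal O(h^{8}).$$ 3. Six is the maximum accuracy order of a compact nine-point scheme at $p$. Here a scheme is $\sum_{k,\ell}C_{k,\ell}(h)u_h(p+(kh,\ell h))=\sum_{(m,n)\in\Lambda_N}f^{(m,n)}F_{m,n}(h)$ with some $N\ge0$ such that $a$ is $C^{N+1}$ near $p$, and arbitrary functions $C_{k,\ell},F_{m,n}$ of $h$ such that not all $C_{k,\ell}(h)$ tend to $0$ as $h\to0^+$; it has accuracy order $q\in\mathbb N_0$ if, for every $u\in C^\infty(\mathbb R^2)$ and $f=-\nabla\cdot(a\nabla u)$, the difference of its two sides with $u_h=u$ is $\mathcal O(h^{q+2})$ as $h\to0^+$. The largest $q$ for which a scheme of accuracy order $q$ exists is $6$. -/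

import Mathlib

open Set Filter Topology
open scoped ContDiff BigOperators

noncomputable section

namespace CompactFD

/-! ### Partial derivatives and the elliptic operator -/

/-- The partial derivative `∂g/∂x`. -/
def dx (g : ℝ × ℝ → ℝ) : ℝ × ℝ → ℝ :=
  fun q => deriv (fun s => g (s, q.2)) q.1

/-- The partial derivative `∂g/∂y`. -/
def dy (g : ℝ × ℝ → ℝ) : ℝ × ℝ → ℝ :=
  fun q => deriv (fun t => g (q.1, t)) q.2

/-- The partial derivative `g^{(m,n)} = ∂^{m+n} g / ∂x^m ∂y^n`, as a function. -/
def pderiv (m n : ℕ) (g : ℝ × ℝ → ℝ) : ℝ × ℝ → ℝ :=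
  dx^[m] (dy^[n] g)

/-- The elliptic operator `-∇·(a∇u)`. -/
def ellip (a u : ℝ × ℝ → ℝ) : ℝ × ℝ → ℝ :=
  fun q => -(dx (fun z => a z * dx u z) q + dy (fun z => a z * dy u z) q)

/-! ### The domain, the interface and regular points -/

/-- `Ω = (l₁, l₂) × (l₃, l₄)`. -/
def rect (l₁ l₂ l₃ l₄ : ℝ) : Set (ℝ × ℝ) := Ioo l₁ l₂ ×ˢ Ioo l₃ l₄

/-- `Ω⁺ = {ψ > 0}`. -/
def omegaPlus (Ω : Set (ℝ × ℝ)) (ψ : ℝ × ℝ → ℝ) : Set (ℝ × ℝ) := {q ∈ Ω | 0 < ψ q}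

/-- `Ω⁻ = {ψ < 0}`. -/
def omegaMinus (Ω : Set (ℝ × ℝ)) (ψ : ℝ × ℝ → ℝ) : Set (ℝ × ℝ) := {q ∈ Ω | ψ q < 0}

/-- The interface `Γ_I = {ψ = 0}`. -/
def interface (Ω : Set (ℝ × ℝ)) (ψ : ℝ × ℝ → ℝ) : Set (ℝ × ℝ) := {q ∈ Ω | ψ q = 0}

/-- The stencil indices `{-1, 0, 1}`. -/
def stIdx : Finset ℤ := Finset.Icc (-1) 1

/-- The stencil point `p + (k h, ℓ h)`. -/
def stPt (p : ℝ × ℝ) (h : ℝ) (k l : ℤ) : ℝ × ℝ := (p.1 + k * h, p.2 + l * h)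

/-- `d⁺`: the stencil indices whose points satisfy `ψ ≥ 0`. -/
def dPlus (ψ : ℝ × ℝ → ℝ) (p : ℝ × ℝ) (h : ℝ) : Set (ℤ × ℤ) :=
  {κ | κ.1 ∈ stIdx ∧ κ.2 ∈ stIdx ∧ 0 ≤ ψ (stPt p h κ.1 κ.2)}

/-- `d⁻`: the stencil indices whose points satisfy `ψ < 0`. -/
def dMinus (ψ : ℝ × ℝ → ℝ) (p : ℝ × ℝ) (h : ℝ) : Set (ℤ × ℤ) :=
  {κ | κ.1 ∈ stIdx ∧ κ.2 ∈ stIdx ∧ ψ (stPt p h κ.1 κ.2) < 0}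

/-- The centre `p` of the stencil of mesh size `h` is a regular point:
`d⁺ = ∅` or `d⁻ = ∅`. -/
def IsRegularPoint (ψ : ℝ × ℝ → ℝ) (p : ℝ × ℝ) (h : ℝ) : Prop :=
  dPlus ψ p h = ∅ ∨ dMinus ψ p h = ∅

/-- The coefficient `a` is positive and of class `C⁶` in each of the subregions. -/
structure IsCoefficient (Ω : Set (ℝ × ℝ)) (ψ a : ℝ × ℝ → ℝ) : Prop where
  pos_plus : ∀ q ∈ omegaPlus Ω ψ, 0 < a q
  pos_minus : ∀ q ∈ omegaMinus Ω ψ, 0 < a q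
  smooth_plus : ContDiffOn ℝ 6 a (omegaPlus Ω ψ)
  smooth_minus : ContDiffOn ℝ 6 a (omegaMinus Ω ψ)

/-- `u` is of class `C⁷` with locally Lipschitz derivatives of order seven in each of the
subregions, and `-∇·(a∇u) = f` in `Ω \ Γ_I`. Nothing is asked on the interface or on
the boundary of `Ω`. -/
structure IsSolution (Ω : Set (ℝ × ℝ)) (ψ a u f : ℝ × ℝ → ℝ) : Prop where
  smooth_plus : ContDiffOn ℝ 7 u (omegaPlus Ω ψ)
  smooth_minus : ContDiffOn ℝ 7 u (omegaMinus Ω ψ)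
  lip_plus : ∀ m n, m + n = 7 → LocallyLipschitzOn (omegaPlus Ω ψ) (pderiv m n u)
  lip_minus : ∀ m n, m + n = 7 → LocallyLipschitzOn (omegaMinus Ω ψ) (pderiv m n u)
  pde : ∀ q ∈ Ω \ interface Ω ψ, ellip a u q = f q

/-! ### Index sets -/

/-- `Λ_K = {(m, n) : m + n ≤ K}`. -/
def Lam (K : ℕ) : Finset (ℕ × ℕ) :=
  (Finset.range (K + 1) ×ˢ Finset.range (K + 1)).filter fun μ => μ.1 + μ.2 ≤ K

/-- `Λ_K^{V,1}`: the elements `(m, n)` of `Λ_K` with `m ∈ {0, 1}`. -/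
def LamV1 (K : ℕ) : Finset (ℕ × ℕ) := (Lam K).filter fun μ => μ.1 ≤ 1

/-- `Λ_K^{V,2} = Λ_K \ Λ_K^{V,1}`. -/
def LamV2 (K : ℕ) : Finset (ℕ × ℕ) := Lam K \ LamV1 K

/-! ### The constants `A^{V,u}`, `A^{V,f}` and the functions `G^V`, `Q^V`

At the base point write `α i j = a^{(i,j)}`. Applying `∂_x^m ∂_y^n` to
`a (u_xx + u_yy) + a_x u_x + a_y u_y = -f` and solving for the term `a^{(0,0)} u^{(m+2,n)}`
gives a recursion that determines every `u^{(m,n)}` from the `u^{(0,n)}`, the `u^{(1,n)}` and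
the `f^{(m,n)}`. -/

/-- The values `u^{(m,n)}` determined by `u^{(m,n)} = v m n` for `m ∈ {0, 1}`, by
`f^{(m,n)} = φ m n`, and by the differentiated equation. -/
def solJet (α v φ : ℕ → ℕ → ℝ) : ℕ → ℕ → ℝ
  | 0, n => v 0 n
  | 1, n => v 1 n
  | m + 2, n =>
    -(α 0 0)⁻¹ * (φ m n + α 0 0 * solJet α v φ m (n + 2)
      + ∑ i : Fin (m + 1), ∑ j : Fin (n + 1), (m.choose i : ℝ) * (n.choose j : ℝ) *
          (if _hij : (i : ℕ) + (j : ℕ) = 0 then 0 else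
            α i j * (solJet α v φ (m + 2 - i) (n - j) + solJet α v φ (m - i) (n + 2 - j)))
      + ∑ i : Fin (m + 1), ∑ j : Fin (n + 1), (m.choose i : ℝ) * (n.choose j : ℝ) *
          (α (i + 1) j * solJet α v φ (m + 1 - i) (n - j)
            + α i (j + 1) * solJet α v φ (m - i) (n + 1 - j)))
termination_by m n => (m + n, m)
decreasing_by all_goals (simp only [Prod.lex_def]; omega)

/-- The array with entry `1` at `(m, n)` and `0` elsewhere. -/
def unitJet (m n : ℕ) : ℕ → ℕ → ℝ := fun i j => if i = m ∧ j = n then 1 else 0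

/-- `A^{V,u}_{m',n',m,n}`: the coefficient of `u^{(m,n)}` in `u^{(m',n')}`. -/
def AVu (α : ℕ → ℕ → ℝ) (m' n' m n : ℕ) : ℝ := solJet α (unitJet m n) 0 m' n'

/-- `A^{V,f}_{m',n',m,n}`: the coefficient of `f^{(m,n)}` in `u^{(m',n')}`. -/
def AVf (α : ℕ → ℕ → ℝ) (m' n' m n : ℕ) : ℝ := solJet α 0 (unitJet m n) m' n'

/-- `G^V_{M,m,n}(x,y)`, for `(m, n) ∈ Λ_{M+1}^{V,1}`. -/
def GV (α : ℕ → ℕ → ℝ) (M m n : ℕ) (x y : ℝ) : ℝ :=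
  ∑ l ∈ Finset.range (n / 2 + 1),
      (-1) ^ l * x ^ (m + 2 * l) * y ^ (n - 2 * l)
        / ((m + 2 * l).factorial * (n - 2 * l).factorial)
    + ∑ μ ∈ LamV2 (M + 1) \ LamV2 (m + n),
      AVu α μ.1 μ.2 m n * (x ^ μ.1 * y ^ μ.2 / (μ.1.factorial * μ.2.factorial))

/-- `Q^V_{M,m,n}(x,y)`, for `(m, n) ∈ Λ_{M-1}`. -/
def QV (α : ℕ → ℕ → ℝ) (M m n : ℕ) (x y : ℝ) : ℝ :=
  ∑ l ∈ Finset.Icc 1 (1 + n / 2),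
      (-1) ^ l * x ^ (m + 2 * l) * y ^ (n + 2 - 2 * l)
        / ((m + 2 * l).factorial * (n + 2 - 2 * l).factorial) * (1 / α 0 0)
    + ∑ μ ∈ LamV2 (M + 1) \ LamV2 (m + n + 2),
      AVf α μ.1 μ.2 m n * (x ^ μ.1 * y ^ μ.2 / (μ.1.factorial * μ.2.factorial))

/-- The derivatives `a^{(i,j)}` at the base point `p`. -/
def jetAt (a : ℝ × ℝ → ℝ) (p : ℝ × ℝ) : ℕ → ℕ → ℝ := fun i j => pderiv i j a p

/-! ### Compact nine-point schemes -/

/-- `C_{k,ℓ}(h) = ∑_{i=0}^{M+1} c_{k,ℓ,i} h^i`. -/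
def polyCoeff (M : ℕ) (c : ℤ → ℤ → ℕ → ℝ) (k l : ℤ) (h : ℝ) : ℝ :=
  ∑ i ∈ Finset.range (M + 2), c k l i * h ^ i

/-- The order-matching linear system for `c`:
`∑_{k,ℓ} C_{k,ℓ}(h) G^V_{M,m,n}(kh, ℓh) = O(h^{M+2})` for all `(m,n) ∈ Λ_{M+1}^{V,1}`. -/
def SolvesSystem (α : ℕ → ℕ → ℝ) (M : ℕ) (c : ℤ → ℤ → ℕ → ℝ) : Prop :=
  ∀ μ ∈ LamV1 (M + 1),
    (fun h : ℝ => ∑ k ∈ stIdx, ∑ l ∈ stIdx,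
      polyCoeff M c k l h * GV α M μ.1 μ.2 (k * h) (l * h)) =O[𝓝[>] 0] fun h => h ^ (M + 2)

/-- Nontriviality of `c`: some `C_{k,ℓ}(0) = c_{k,ℓ,0}` is nonzero. -/
def Nontriv (c : ℤ → ℤ → ℕ → ℝ) : Prop := ∃ k ∈ stIdx, ∃ l ∈ stIdx, c k l 0 ≠ 0

/-- `C_{f,m,n}(h) = ∑_{k,ℓ} C_{k,ℓ}(h) Q^V_{M,m,n}(kh, ℓh)`. -/
def rhsCoeff (α : ℕ → ℕ → ℝ) (M : ℕ) (c : ℤ → ℤ → ℕ → ℝ) (m n : ℕ) (h : ℝ) : ℝ :=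
  ∑ k ∈ stIdx, ∑ l ∈ stIdx, polyCoeff M c k l h * QV α M m n (k * h) (l * h)

/-- The nine-point operator `L_h u = ∑_{k,ℓ} C_{k,ℓ}(h) u(p + (kh, ℓh))`. -/
def stencilOp (C : ℤ → ℤ → ℝ → ℝ) (p : ℝ × ℝ) (u : ℝ × ℝ → ℝ) (h : ℝ) : ℝ :=
  ∑ k ∈ stIdx, ∑ l ∈ stIdx, C k l h * u (stPt p h k l)

/-- The truncation error `L_h u - ∑_{(m,n) ∈ Λ_N} f^{(m,n)} F_{m,n}(h)`, the derivatives of `f`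
being taken at the centre `p`. -/
def truncError (N : ℕ) (C : ℤ → ℤ → ℝ → ℝ) (F : ℕ → ℕ → ℝ → ℝ) (p : ℝ × ℝ)
    (u f : ℝ × ℝ → ℝ) (h : ℝ) : ℝ :=
  stencilOp C p u h - ∑ μ ∈ Lam N, pderiv μ.1 μ.2 f p * F μ.1 μ.2 h

/-- The compact scheme `∑_{k,ℓ} C_{k,ℓ}(h) u(p + (kh, ℓh)) = ∑_{(m,n) ∈ Λ_N} f^{(m,n)} F_{m,n}(h)`,
with arbitrary functions `C_{k,ℓ}`, `F_{m,n}` of `h`, is nontrivial (the `C_{k,ℓ}(h)` do not all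
tend to `0` as `h → 0+`) and has accuracy order `q` at `p` for `-∇·(a∇u) = f`: for
smooth `u` and `f = -∇·(a∇u)` its truncation error is `O(h^{q+2})`. -/
def HasAccuracyOrder (a : ℝ × ℝ → ℝ) (p : ℝ × ℝ) (N : ℕ) (C : ℤ → ℤ → ℝ → ℝ)
    (F : ℕ → ℕ → ℝ → ℝ) (q : ℕ) : Prop :=
  (¬ ∀ k ∈ stIdx, ∀ l ∈ stIdx, Tendsto (C k l) (𝓝[>] 0) (𝓝 0)) ∧
  ∀ u : ℝ × ℝ → ℝ, ContDiff ℝ ∞ u →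
    truncError N C F p u (ellip a u) =O[𝓝[>] 0] fun h : ℝ => h ^ (q + 2)

end CompactFD

end

open CompactFD

/-!
The equation determines the jet of a solution at `p` from its entries with `m ≤ 1` and the jet of
`f`, and `G` and `Q` collect the Taylor polynomials of the corresponding basis solutions. So order
matching says that the stencil annihilates the Taylor polynomials of the homogeneous solutions up
to `O(h⁸)`, which gives the truncation error by linearity.

The leading part of `G_{m,n}` is a harmonic polynomial of degree `m + n`. Hence the values at
`h = 0` of any matching coefficients form weights annihilating the harmonic polynomials of degree at
most four. Such weights are multiples of the nine-point Laplacian (`-20` at the centre, `4` at the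
edges, `1` at the corners), which vanishes neither on `x²`, whence `λ ≠ 0`, nor on the harmonic
polynomials of degree eight, whence the order is at most six.

For existence put `w = √a` and `v = w u`: then `∇·(a∇u) = 0` becomes `Δv = q v` with `q = Δw / w`.
On the nine-point stencil the Laplacian of `v` is `6h²Δv + h⁴/2 Δ²v + h⁶/60 (Δ³v + 2 ∂x²∂y²Δv)` up
to `O(h⁸)`, and the derivatives of `Δv = q v` occurring here are replaced by compact differences
of `q v`. Multiplying the resulting coefficients by `w` and truncating them at `h⁷` solves the
system.
-/

namespace CompactFD

/-! ### Calculus of the partial derivatives -/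

section PartialDerivatives

variable {f g : ℝ × ℝ → ℝ} {p q : ℝ × ℝ} {n : ℕ}

theorem dx_congr (h : f =ᶠ[𝓝 p] g) : dx f =ᶠ[𝓝 p] dx g := by
  filter_upwards [h.eventuallyEq_nhds] with q hq
  have hslice : Tendsto (fun s : ℝ => (s, q.2)) (𝓝 q.1) (𝓝 q) :=
    Continuous.tendsto' (by fun_prop) _ _ rfl
  exact EventuallyEq.deriv_eq (hslice.eventually hq)

theorem dy_congr (h : f =ᶠ[𝓝 p] g) : dy f =ᶠ[𝓝 p] dy g := by
  filter_upwards [h.eventuallyEq_nhds] with q hq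
  have hslice : Tendsto (fun t : ℝ => (q.1, t)) (𝓝 q.2) (𝓝 q) :=
    Continuous.tendsto' (by fun_prop) _ _ rfl
  exact EventuallyEq.deriv_eq (hslice.eventually hq)

theorem iterate_dx_congr (m : ℕ) (h : f =ᶠ[𝓝 p] g) : dx^[m] f =ᶠ[𝓝 p] dx^[m] g := by
  induction m generalizing f g with
  | zero => exact h
  | succ _ ih => exact ih (dx_congr h)

theorem iterate_dy_congr (n : ℕ) (h : f =ᶠ[𝓝 p] g) : dy^[n] f =ᶠ[𝓝 p] dy^[n] g := by
  induction n generalizing f g with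
  | zero => exact h
  | succ _ ih => exact ih (dy_congr h)

theorem pderiv_congr (m n : ℕ) (h : f =ᶠ[𝓝 p] g) : pderiv m n f =ᶠ[𝓝 p] pderiv m n g :=
  iterate_dx_congr m (iterate_dy_congr n h)

theorem hasDerivAt_fst_slice (h : DifferentiableAt ℝ g q) :
    HasDerivAt (fun s => g (s, q.2)) (fderiv ℝ g q (1, 0)) q.1 :=
  h.hasFDerivAt.comp_hasDerivAt (f := fun s : ℝ => (s, q.2)) q.1
    ((hasDerivAt_id q.1).prodMk (hasDerivAt_const q.1 q.2))

theorem hasDerivAt_snd_slice (h : DifferentiableAt ℝ g q) :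
    HasDerivAt (fun t => g (q.1, t)) (fderiv ℝ g q (0, 1)) q.2 :=
  h.hasFDerivAt.comp_hasDerivAt (f := fun t : ℝ => (q.1, t)) q.2
    ((hasDerivAt_const q.2 q.1).prodMk (hasDerivAt_id q.2))

theorem dx_eq_fderiv (h : DifferentiableAt ℝ g q) : dx g q = fderiv ℝ g q (1, 0) :=
  (hasDerivAt_fst_slice h).deriv

theorem dy_eq_fderiv (h : DifferentiableAt ℝ g q) : dy g q = fderiv ℝ g q (0, 1) :=
  (hasDerivAt_snd_slice h).deriv

theorem contDiffAt_of_nat_le {m : ℕ} (h : ContDiffAt ℝ n g p) (hmn : m ≤ n) :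
    ContDiffAt ℝ m g p :=
  h.of_le (by exact_mod_cast hmn)

theorem eventually_differentiableAt (h : ContDiffAt ℝ (n + 1 : ℕ) g p) :
    ∀ᶠ q in 𝓝 p, DifferentiableAt ℝ g q := by
  filter_upwards [h.eventually (by simp)] with q hq
  exact hq.differentiableAt (by simp)

theorem dx_eventuallyEq_fderiv (h : ContDiffAt ℝ (n + 1 : ℕ) g p) :
    dx g =ᶠ[𝓝 p] fun q => fderiv ℝ g q (1, 0) := by
  filter_upwards [eventually_differentiableAt h] with q hq using dx_eq_fderiv hq

theorem dy_eventuallyEq_fderiv (h : ContDiffAt ℝ (n + 1 : ℕ) g p) :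
    dy g =ᶠ[𝓝 p] fun q => fderiv ℝ g q (0, 1) := by
  filter_upwards [eventually_differentiableAt h] with q hq using dy_eq_fderiv hq

theorem contDiffAt_fderiv_apply (v : ℝ × ℝ) (h : ContDiffAt ℝ (n + 1 : ℕ) g p) :
    ContDiffAt ℝ n (fun q => fderiv ℝ g q v) p :=
  (h.fderiv_right (m := n) (by norm_cast)).clm_apply contDiffAt_const

theorem contDiffAt_dx (h : ContDiffAt ℝ (n + 1 : ℕ) g p) : ContDiffAt ℝ n (dx g) p :=
  (contDiffAt_fderiv_apply _ h).congr_of_eventuallyEq (dx_eventuallyEq_fderiv h)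

theorem contDiffAt_dy (h : ContDiffAt ℝ (n + 1 : ℕ) g p) : ContDiffAt ℝ n (dy g) p :=
  (contDiffAt_fderiv_apply _ h).congr_of_eventuallyEq (dy_eventuallyEq_fderiv h)

theorem contDiffAt_iterate_dx (i : ℕ) (h : ContDiffAt ℝ (n + i : ℕ) g p) :
    ContDiffAt ℝ n (dx^[i] g) p := by
  induction i generalizing g with
  | zero => exact h
  | succ i ih => exact ih (contDiffAt_dx h)

theorem contDiffAt_iterate_dy (j : ℕ) (h : ContDiffAt ℝ (n + j : ℕ) g p) :
    ContDiffAt ℝ n (dy^[j] g) p := by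
  induction j generalizing g with
  | zero => exact h
  | succ j ih => exact ih (contDiffAt_dy h)

theorem contDiffAt_pderiv (i j : ℕ) (h : ContDiffAt ℝ (n + i + j : ℕ) g p) :
    ContDiffAt ℝ n (pderiv i j g) p :=
  contDiffAt_iterate_dx i (contDiffAt_iterate_dy j h)

theorem fderiv_fderiv_apply (h : ContDiffAt ℝ (2 : ℕ) g q) (v w : ℝ × ℝ) :
    fderiv ℝ (fun z => fderiv ℝ g z v) q w = fderiv ℝ (fderiv ℝ g) q w v := by
  have hd : DifferentiableAt ℝ (fderiv ℝ g) q :=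
    (h.fderiv_right (m := 1) (by norm_cast)).differentiableAt (by simp)
  rw [(hd.hasFDerivAt.clm_apply (hasFDerivAt_const v q)).fderiv]
  simp

theorem dy_dx_eq_dx_dy (h : ContDiffAt ℝ (2 : ℕ) g q) : dy (dx g) q = dx (dy g) q := by
  have h' : ContDiffAt ℝ (1 + 1 : ℕ) g q := h
  have hd (v : ℝ × ℝ) : DifferentiableAt ℝ (fun z => fderiv ℝ g z v) q :=
    (contDiffAt_fderiv_apply v h').differentiableAt (by simp)
  rw [(dy_congr (dx_eventuallyEq_fderiv h')).eq_of_nhds,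
    (dx_congr (dy_eventuallyEq_fderiv h')).eq_of_nhds, dx_eq_fderiv (hd _), dy_eq_fderiv (hd _),
    fderiv_fderiv_apply h, fderiv_fderiv_apply h]
  exact (h.isSymmSndFDerivAt (by simp)).eq _ _

theorem iterate_dy_dx_eventuallyEq (n : ℕ) (h : ContDiffAt ℝ (n + 1 : ℕ) g p) :
    dy^[n] (dx g) =ᶠ[𝓝 p] dx (dy^[n] g) := by
  induction n generalizing g with
  | zero => rfl
  | succ n ih =>
    have hcomm : dy (dx g) =ᶠ[𝓝 p] dx (dy g) := by
      filter_upwards [(contDiffAt_of_nat_le h (show 2 ≤ n + 1 + 1 by omega)).eventually (by simp)]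
        with q hq using dy_dx_eq_dx_dy hq
    exact (iterate_dy_congr n hcomm).trans (ih (contDiffAt_dy h))

theorem pderiv_dx (m n : ℕ) (h : ContDiffAt ℝ (n + 1 : ℕ) g p) :
    pderiv m n (dx g) =ᶠ[𝓝 p] pderiv (m + 1) n g :=
  iterate_dx_congr m (iterate_dy_dx_eventuallyEq n h)

theorem iterate_dx_apply (n : ℕ) (g : ℝ × ℝ → ℝ) (q : ℝ × ℝ) :
    dx^[n] g q = iteratedDeriv n (fun s => g (s, q.2)) q.1 := by
  induction n generalizing q with
  | zero => simp
  | succ n ih => simp only [Function.iterate_succ_apply', iteratedDeriv_succ, dx, ih]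

theorem iterate_dy_apply (n : ℕ) (g : ℝ × ℝ → ℝ) (q : ℝ × ℝ) :
    dy^[n] g q = iteratedDeriv n (fun t => g (q.1, t)) q.2 := by
  induction n generalizing q with
  | zero => simp
  | succ n ih => simp only [Function.iterate_succ_apply', iteratedDeriv_succ, dy, ih]

theorem contDiffAt_fst_slice (h : ContDiffAt ℝ n g q) :
    ContDiffAt ℝ n (fun s => g (s, q.2)) q.1 :=
  ContDiffAt.comp (f := fun s : ℝ => (s, q.2)) q.1 h (by fun_prop)

theorem contDiffAt_snd_slice (h : ContDiffAt ℝ n g q) :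
    ContDiffAt ℝ n (fun t => g (q.1, t)) q.2 :=
  ContDiffAt.comp (f := fun t : ℝ => (q.1, t)) q.2 h (by fun_prop)

theorem pderiv_add (m n : ℕ) (hf : ContDiffAt ℝ (m + n : ℕ) f p)
    (hg : ContDiffAt ℝ (m + n : ℕ) g p) :
    pderiv m n (fun q => f q + g q) p = pderiv m n f p + pderiv m n g p := by
  have hy : dy^[n] (fun q => f q + g q) =ᶠ[𝓝 p] fun q => dy^[n] f q + dy^[n] g q := by
    filter_upwards [(contDiffAt_of_nat_le hf (Nat.le_add_left n m)).eventually (by simp),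
      (contDiffAt_of_nat_le hg (Nat.le_add_left n m)).eventually (by simp)] with q hfq hgq
    simp only [iterate_dy_apply]
    exact iteratedDeriv_fun_add (contDiffAt_snd_slice hfq) (contDiffAt_snd_slice hgq)
  simp only [pderiv, (iterate_dx_congr m hy).eq_of_nhds, iterate_dx_apply]
  exact iteratedDeriv_fun_add (contDiffAt_fst_slice (contDiffAt_iterate_dy n hf))
    (contDiffAt_fst_slice (contDiffAt_iterate_dy n hg))

theorem pderiv_neg (m n : ℕ) (f : ℝ × ℝ → ℝ) (p : ℝ × ℝ) :
    pderiv m n (fun q => -f q) p = -pderiv m n f p := by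
  have hy : dy^[n] (fun q => -f q) = fun q => -dy^[n] f q := by
    funext q
    simp only [iterate_dy_apply, iteratedDeriv_fun_neg]
  simp only [pderiv, hy, iterate_dx_apply, iteratedDeriv_fun_neg]

/-- The Leibniz product of two arrays of derivatives: the array of derivatives of a product is
the Leibniz product of those of its factors. -/
noncomputable def leib (A B : ℕ → ℕ → ℝ) (m n : ℕ) : ℝ :=
  ∑ i ∈ Finset.range (m + 1), ∑ j ∈ Finset.range (n + 1),
    (m.choose i : ℝ) * (n.choose j : ℝ) * (A i j * B (m - i) (n - j))

theorem leib_congr {A B A' B' : ℕ → ℕ → ℝ} {m n : ℕ}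
    (hA : ∀ i j, i + j ≤ m + n → A i j = A' i j) (hB : ∀ i j, i + j ≤ m + n → B i j = B' i j) :
    leib A B m n = leib A' B' m n := by
  refine Finset.sum_congr rfl fun i hi => Finset.sum_congr rfl fun j hj => ?_
  rw [Finset.mem_range] at hi hj
  rw [hA i j (by omega), hB (m - i) (n - j) (by omega)]

theorem iterate_dy_mul (n : ℕ) (hf : ContDiffAt ℝ n f p) (hg : ContDiffAt ℝ n g p) :
    dy^[n] (fun q => f q * g q) =ᶠ[𝓝 p] fun q =>
      ∑ j ∈ Finset.range (n + 1), (n.choose j : ℝ) * (dy^[j] f q * dy^[n - j] g q) := by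
  filter_upwards [hf.eventually (by simp), hg.eventually (by simp)] with q hfq hgq
  simp only [iterate_dy_apply, ← mul_assoc]
  exact iteratedDeriv_fun_mul (contDiffAt_snd_slice hfq) (contDiffAt_snd_slice hgq)

theorem pderiv_mul (m n : ℕ) (hf : ContDiffAt ℝ (m + n : ℕ) f p)
    (hg : ContDiffAt ℝ (m + n : ℕ) g p) :
    pderiv m n (fun q => f q * g q) p = leib (jetAt f p) (jetAt g p) m n := by
  have hslice {w : ℝ × ℝ → ℝ} (hw : ContDiffAt ℝ (m + n : ℕ) w p) {j : ℕ} (hj : j ≤ n) :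
      ContDiffAt ℝ m (fun s => dy^[j] w (s, p.2)) p.1 :=
    contDiffAt_fst_slice (contDiffAt_iterate_dy j (contDiffAt_of_nat_le hw (by omega)))
  have hfj : ∀ j ∈ Finset.range (n + 1), ContDiffAt ℝ m (fun s => dy^[j] f (s, p.2)) p.1 :=
    fun j hj => hslice hf (Finset.mem_range_succ_iff.1 hj)
  have hgj : ∀ j ∈ Finset.range (n + 1), ContDiffAt ℝ m (fun s => dy^[n - j] g (s, p.2)) p.1 :=
    fun j _ => hslice hg (Nat.sub_le n j)
  rw [pderiv, (iterate_dx_congr m (iterate_dy_mul n (contDiffAt_of_nat_le hf (Nat.le_add_left n m))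
      (contDiffAt_of_nat_le hg (Nat.le_add_left n m)))).eq_of_nhds, iterate_dx_apply,
    iteratedDeriv_fun_sum fun j hj => contDiffAt_const.mul ((hfj j hj).mul (hgj j hj)), leib,
    Finset.sum_comm]
  refine Finset.sum_congr rfl fun j hj => ?_
  rw [iteratedDeriv_const_mul_field, iteratedDeriv_fun_mul (hfj j hj) (hgj j hj), Finset.mul_sum]
  refine Finset.sum_congr rfl fun i _ => ?_
  simp only [jetAt, pderiv, iterate_dx_apply]
  ring

theorem dx_mul (hf : DifferentiableAt ℝ f q) (hg : DifferentiableAt ℝ g q) :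
    dx (fun z => f z * g z) q = dx f q * g q + f q * dx g q := by
  rw [dx_eq_fderiv hf, dx_eq_fderiv hg]
  exact ((hasDerivAt_fst_slice hf).mul (hasDerivAt_fst_slice hg)).deriv

theorem dy_mul (hf : DifferentiableAt ℝ f q) (hg : DifferentiableAt ℝ g q) :
    dy (fun z => f z * g z) q = dy f q * g q + f q * dy g q := by
  rw [dy_eq_fderiv hf, dy_eq_fderiv hg]
  exact ((hasDerivAt_snd_slice hf).mul (hasDerivAt_snd_slice hg)).deriv

end PartialDerivatives

/-! ### The jet of the elliptic operator -/

section EllipticJet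

variable {a u : ℝ × ℝ → ℝ} {p : ℝ × ℝ}

theorem ellip_congr {b v : ℝ × ℝ → ℝ} (hab : a =ᶠ[𝓝 p] b) (huv : u =ᶠ[𝓝 p] v) :
    ellip a u =ᶠ[𝓝 p] ellip b v :=
  ((dx_congr (hab.mul (dx_congr huv))).add (dy_congr (hab.mul (dy_congr huv)))).neg

theorem ellip_eventuallyEq (ha : ContDiffAt ℝ (1 : ℕ) a p) (hu : ContDiffAt ℝ (2 : ℕ) u p) :
    ellip a u =ᶠ[𝓝 p] fun q => -(a q * (dx (dx u) q + dy (dy u) q)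
      + dx a q * dx u q + dy a q * dy u q) := by
  filter_upwards [eventually_differentiableAt (n := 0) ha,
    eventually_differentiableAt (n := 0) (contDiffAt_dx (n := 1) hu),
    eventually_differentiableAt (n := 0) (contDiffAt_dy (n := 1) hu)] with q haq huxq huyq
  rw [ellip, dx_mul haq huxq, dy_mul haq huyq]
  ring

/-- The map taking the jet of `u` to that of `∇·(a∇u) = a Δu + a_x u_x + a_y u_y`, where `α` is
the jet of `a`. -/
noncomputable def divGradJet (α : ℕ → ℕ → ℝ) : (ℕ → ℕ → ℝ) →ₗ[ℝ] ℕ → ℕ → ℝ where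
  toFun U m n := leib α (fun i j => U (i + 2) j + U i (j + 2)) m n
    + leib (fun i j => α (i + 1) j) (fun i j => U (i + 1) j) m n
    + leib (fun i j => α i (j + 1)) (fun i j => U i (j + 1)) m n
  map_add' U V := by
    ext m n
    simp only [leib, Pi.add_apply, mul_add, Finset.sum_add_distrib]
    ring
  map_smul' c U := by
    ext m n
    simp only [leib, Pi.smul_apply, smul_eq_mul, RingHom.id_apply, mul_add, Finset.mul_sum,
      mul_left_comm c]

theorem divGradJet_apply (α U : ℕ → ℕ → ℝ) (m n : ℕ) :
    divGradJet α U m n = leib α (fun i j => U (i + 2) j + U i (j + 2)) m n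
      + leib (fun i j => α (i + 1) j) (fun i j => U (i + 1) j) m n
      + leib (fun i j => α i (j + 1)) (fun i j => U i (j + 1)) m n :=
  rfl

theorem divGradJet_congr {α β U V : ℕ → ℕ → ℝ} {m n : ℕ}
    (hα : ∀ i j, i + j ≤ m + n + 1 → α i j = β i j)
    (hU : ∀ i j, i + j ≤ m + n + 2 → U i j = V i j) :
    divGradJet α U m n = divGradJet β V m n := by
  rw [divGradJet_apply, divGradJet_apply]
  refine congrArg₂ (· + ·) (congrArg₂ (· + ·) ?_ ?_) ?_ <;>
    refine leib_congr (fun i j hij => ?_) fun i j hij => ?_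
  · exact hα i j (by omega)
  · rw [hU (i + 2) j (by omega), hU i (j + 2) (by omega)]
  all_goals first | exact hα _ _ (by omega) | exact hU _ _ (by omega)

theorem jetAt_dx {g : ℝ × ℝ → ℝ} {n : ℕ} (m : ℕ) (h : ContDiffAt ℝ (n + 1 : ℕ) g p) :
    jetAt (dx g) p m n = jetAt g p (m + 1) n :=
  (pderiv_dx m n h).eq_of_nhds

theorem jetAt_dx_dx {g : ℝ × ℝ → ℝ} {n : ℕ} (m : ℕ) (h : ContDiffAt ℝ (n + 2 : ℕ) g p) :
    jetAt (dx (dx g)) p m n = jetAt g p (m + 2) n := by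
  rw [jetAt_dx m (contDiffAt_dx (n := n + 1) h),
    jetAt_dx (m + 1) (contDiffAt_of_nat_le h (Nat.le_succ (n + 1)))]

theorem jetAt_laplacian {g : ℝ × ℝ → ℝ} {m n : ℕ} (h : ContDiffAt ℝ (m + n + 2 : ℕ) g p) :
    jetAt (fun q => dx (dx g) q + dy (dy g) q) p m n =
      jetAt g p (m + 2) n + jetAt g p m (n + 2) := by
  rw [jetAt, pderiv_add m n (contDiffAt_dx (contDiffAt_dx h)) (contDiffAt_dy (contDiffAt_dy h))]
  exact congrArg (· + _) (jetAt_dx_dx m (contDiffAt_of_nat_le h (by omega)))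

theorem pderiv_ellip (m n : ℕ) (ha : ContDiffAt ℝ (m + n + 1 : ℕ) a p)
    (hu : ContDiffAt ℝ (m + n + 2 : ℕ) u p) :
    pderiv m n (ellip a u) p = -divGradJet (jetAt a p) (jetAt u p) m n := by
  have ha0 : ContDiffAt ℝ (m + n : ℕ) a p := contDiffAt_of_nat_le ha (by omega)
  have hu1 : ContDiffAt ℝ (m + n + 1 : ℕ) u p := contDiffAt_of_nat_le hu (by omega)
  have hlap : ContDiffAt ℝ (m + n : ℕ) (fun q => dx (dx u) q + dy (dy u) q) p :=
    (contDiffAt_dx (contDiffAt_dx hu)).add (contDiffAt_dy (contDiffAt_dy hu))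
  have hx := (contDiffAt_dx ha).mul (contDiffAt_dx hu1)
  have hy := (contDiffAt_dy ha).mul (contDiffAt_dy hu1)
  rw [(pderiv_congr m n (ellip_eventuallyEq (contDiffAt_of_nat_le ha (by omega))
      (contDiffAt_of_nat_le hu (by omega)))).eq_of_nhds, pderiv_neg,
    pderiv_add m n ((ha0.mul hlap).add hx) hy, pderiv_add m n (ha0.mul hlap) hx,
    pderiv_mul m n ha0 hlap, pderiv_mul m n (contDiffAt_dx ha) (contDiffAt_dx hu1),
    pderiv_mul m n (contDiffAt_dy ha) (contDiffAt_dy hu1), divGradJet_apply]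
  congr 3
  · exact leib_congr (fun _ _ _ => rfl) fun i j hij =>
      jetAt_laplacian (contDiffAt_of_nat_le hu (by omega))
  · exact leib_congr (fun i j hij => jetAt_dx i (contDiffAt_of_nat_le ha (by omega)))
      fun i j hij => jetAt_dx i (contDiffAt_of_nat_le hu (by omega))

end EllipticJet

/-! ### Taylor polynomials -/

section TaylorPolynomials

variable {K : ℕ} {U V : ℕ → ℕ → ℝ}

theorem mem_Lam {μ : ℕ × ℕ} : μ ∈ Lam K ↔ μ.1 + μ.2 ≤ K := by
  simp only [Lam, Finset.mem_filter, Finset.mem_product, Finset.mem_range]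
  omega

theorem sum_Lam (K : ℕ) (F : ℕ × ℕ → ℝ) :
    ∑ μ ∈ Lam K, F μ = ∑ i ∈ Finset.range (K + 1), ∑ j ∈ Finset.range (K + 1 - i), F (i, j) := by
  rw [← Finset.sum_finset_product' (r := Lam K) (f := fun i j => F (i, j))]
  rintro ⟨i, j⟩
  simp only [mem_Lam, Finset.mem_range]
  omega

theorem sum_Lam_comm (K : ℕ) (F : ℕ × ℕ → ℝ) :
    ∑ μ ∈ Lam K, F μ = ∑ j ∈ Finset.range (K + 1), ∑ i ∈ Finset.range (K + 1 - j), F (i, j) := by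
  rw [← Finset.sum_finset_product_right' (r := Lam K) (f := fun i j => F (i, j))]
  rintro ⟨i, j⟩
  simp only [mem_Lam, Finset.mem_range]
  omega

/-- The polynomial of degree at most `K` whose derivatives of order at most `K` at the origin are
the entries of `U`. -/
noncomputable def taylorPoly (K : ℕ) (U : ℕ → ℕ → ℝ) (x y : ℝ) : ℝ :=
  ∑ μ ∈ Lam K, U μ.1 μ.2 * (x ^ μ.1 * y ^ μ.2 / (μ.1.factorial * μ.2.factorial))

theorem taylorPoly_congr (h : ∀ i j, i + j ≤ K → U i j = V i j) :
    taylorPoly K U = taylorPoly K V := by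
  funext x y
  exact Finset.sum_congr rfl fun μ hμ => by rw [h μ.1 μ.2 (mem_Lam.1 hμ)]

theorem taylorPoly_origin (K : ℕ) (U : ℕ → ℕ → ℝ) : taylorPoly K U 0 0 = U 0 0 := by
  rw [taylorPoly, Finset.sum_eq_single (0, 0)]
  · simp
  · rintro ⟨i, j⟩ - hij
    have : i ≠ 0 ∨ j ≠ 0 := by
      by_contra! h
      exact hij (Prod.ext h.1 h.2)
    rcases this with hi | hj
    · simp [zero_pow hi]
    · simp [zero_pow hj]
  · simp [mem_Lam]

theorem hasDerivAt_pow_div_factorial {z : ℝ → ℝ} {z' t : ℝ} (hz : HasDerivAt z z' t) (i : ℕ) :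
    HasDerivAt (fun t => z t ^ i / i.factorial)
      (if i = 0 then 0 else z' * (z t ^ (i - 1) / (i - 1).factorial)) t := by
  rcases i with _ | i
  · simpa using hasDerivAt_const t (1 : ℝ)
  simp only [Nat.add_eq_zero_iff, one_ne_zero, and_false, if_false, Nat.add_sub_cancel]
  refine ((hz.pow (i + 1)).div_const ((i + 1).factorial : ℝ)).congr_deriv ?_
  have hi : (i + 1 : ℝ) ≠ 0 := by positivity
  have hfac : (i.factorial : ℝ) ≠ 0 := by positivity
  push_cast [Nat.factorial_succ, Nat.add_sub_cancel]
  field_simp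

theorem hasDerivAt_taylorPoly (K : ℕ) (U : ℕ → ℕ → ℝ) {x y : ℝ → ℝ} {x' y' t : ℝ}
    (hx : HasDerivAt x x' t) (hy : HasDerivAt y y' t) :
    HasDerivAt (fun t => taylorPoly (K + 1) U (x t) (y t))
      (x' * taylorPoly K (fun i j => U (i + 1) j) (x t) (y t)
        + y' * taylorPoly K (fun i j => U i (j + 1)) (x t) (y t)) t := by
  have hterms := HasDerivAt.fun_sum (u := Lam (K + 1)) fun μ _ =>
    ((hasDerivAt_pow_div_factorial hx μ.1).mul (hasDerivAt_pow_div_factorial hy μ.2)).const_mul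
      (U μ.1 μ.2)
  refine (hterms.congr_of_eventuallyEq (Eventually.of_forall fun t => ?_)).congr_deriv (Eq.symm ?_)
  · simp only [taylorPoly, Pi.mul_apply, mul_div_mul_comm]
  simp only [mul_add, Finset.sum_add_distrib]
  congr 1
  · rw [sum_Lam, Finset.sum_range_succ', taylorPoly, sum_Lam, Finset.mul_sum]
    simp only [Nat.succ_sub_succ_eq_sub, if_true, zero_mul, mul_zero, Finset.sum_const_zero,
      add_zero, Finset.mul_sum]
    refine Finset.sum_congr rfl fun i _ => Finset.sum_congr rfl fun j _ => ?_
    simp only [Nat.add_eq_zero_iff, one_ne_zero, and_false, if_false, Nat.sub_zero]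
    ring
  · rw [sum_Lam_comm, Finset.sum_range_succ', taylorPoly, sum_Lam_comm, Finset.mul_sum]
    simp only [Nat.succ_sub_succ_eq_sub, if_true, mul_zero, Finset.sum_const_zero,
      add_zero, Finset.mul_sum]
    refine Finset.sum_congr rfl fun i _ => Finset.sum_congr rfl fun j _ => ?_
    simp only [Nat.add_eq_zero_iff, one_ne_zero, and_false, if_false, Nat.sub_zero]
    ring

/-- The polynomial function of degree at most `K` whose derivatives of order at most `K` at `p`
are the entries of `U`. -/
noncomputable def polyAt (K : ℕ) (U : ℕ → ℕ → ℝ) (p : ℝ × ℝ) : ℝ × ℝ → ℝ :=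
  fun q => taylorPoly K U (q.1 - p.1) (q.2 - p.2)

theorem contDiff_polyAt (K : ℕ) (U : ℕ → ℕ → ℝ) (p : ℝ × ℝ) {n : WithTop ℕ∞} :
    ContDiff ℝ n (polyAt K U p) := by
  unfold polyAt taylorPoly
  fun_prop

theorem dx_polyAt (K : ℕ) (U : ℕ → ℕ → ℝ) (p : ℝ × ℝ) :
    dx (polyAt (K + 1) U p) = polyAt K (fun i j => U (i + 1) j) p := by
  funext q
  have h := hasDerivAt_taylorPoly K U ((hasDerivAt_id q.1).sub_const p.1)
    (hasDerivAt_const q.1 (q.2 - p.2))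
  simpa [polyAt, dx] using h.deriv

theorem dy_polyAt (K : ℕ) (U : ℕ → ℕ → ℝ) (p : ℝ × ℝ) :
    dy (polyAt (K + 1) U p) = polyAt K (fun i j => U i (j + 1)) p := by
  funext q
  have h := hasDerivAt_taylorPoly K U (hasDerivAt_const q.2 (q.1 - p.1))
    ((hasDerivAt_id q.2).sub_const p.2)
  simpa [polyAt, dy] using h.deriv

theorem iterate_dx_polyAt (m K : ℕ) (U : ℕ → ℕ → ℝ) (p : ℝ × ℝ) :
    dx^[m] (polyAt (K + m) U p) = polyAt K (fun i j => U (i + m) j) p := by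
  induction m generalizing U with
  | zero => rfl
  | succ m ih => simp only [Function.iterate_succ_apply, ← add_assoc, dx_polyAt, ih]

theorem iterate_dy_polyAt (n K : ℕ) (U : ℕ → ℕ → ℝ) (p : ℝ × ℝ) :
    dy^[n] (polyAt (K + n) U p) = polyAt K (fun i j => U i (j + n)) p := by
  induction n generalizing U with
  | zero => rfl
  | succ n ih => simp only [Function.iterate_succ_apply, ← add_assoc, dy_polyAt, ih]

theorem jetAt_polyAt {m n : ℕ} (h : m + n ≤ K) (U : ℕ → ℕ → ℝ) (p : ℝ × ℝ) :
    jetAt (polyAt K U p) p m n = U m n := by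
  obtain ⟨r, rfl⟩ : ∃ r, K = r + m + n := ⟨K - m - n, by omega⟩
  rw [jetAt, pderiv, iterate_dy_polyAt, iterate_dx_polyAt, polyAt, sub_self, sub_self,
    taylorPoly_origin, zero_add, zero_add]

end TaylorPolynomials

/-! ### Taylor expansion along rays -/

section TaylorRay

theorem isBigO_pow_succ_of_hasDerivAt {E : Type*} [NormedAddCommGroup E] [NormedSpace ℝ E]
    {F F' : ℝ → E} {n : ℕ} (h0 : F 0 = 0) (hF : ∀ᶠ t in 𝓝 0, HasDerivAt F (F' t) t)
    (hF' : F' =O[𝓝 0] fun t => t ^ n) : F =O[𝓝 0] fun t => t ^ (n + 1) := by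
  obtain ⟨c, hc, hbound⟩ := hF'.exists_nonneg
  obtain ⟨ε, hε, hball⟩ := Metric.eventually_nhds_iff_ball.1 (hF.and hbound.bound)
  refine Asymptotics.IsBigO.of_bound c ?_
  filter_upwards [Metric.ball_mem_nhds 0 hε] with t ht
  have hsub : uIcc 0 t ⊆ Metric.ball 0 ε :=
    (convex_ball (0 : ℝ) ε).ordConnected.uIcc_subset (Metric.mem_ball_self hε) ht
  have hF't : ∀ s ∈ uIcc 0 t, ‖F' s‖ ≤ c * ‖t‖ ^ n := fun s hs => by
    have hst : ‖s‖ ≤ ‖t‖ := by simpa using abs_sub_left_of_mem_uIcc hs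
    have hs' := (hball s (hsub hs)).2
    rw [norm_pow] at hs'
    exact hs'.trans (by gcongr)
  have hmean := (convex_uIcc 0 t).norm_image_sub_le_of_norm_hasDerivWithin_le
    (fun s hs => (hball s (hsub hs)).1.hasDerivWithinAt) hF't left_mem_uIcc right_mem_uIcc
  rw [h0, sub_zero, sub_zero] at hmean
  rwa [norm_pow, pow_succ, ← mul_assoc]

variable {g : ℝ × ℝ → ℝ} {p : ℝ × ℝ} (k l : ℝ)

theorem tendsto_ray (p : ℝ × ℝ) :
    Tendsto (fun h : ℝ => (p.1 + k * h, p.2 + l * h)) (𝓝 0) (𝓝 p) :=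
  Continuous.tendsto' (by fun_prop) _ _ (by simp)

theorem hasDerivAt_comp_ray {h : ℝ} (hg : DifferentiableAt ℝ g (p.1 + k * h, p.2 + l * h)) :
    HasDerivAt (fun h : ℝ => g (p.1 + k * h, p.2 + l * h))
      (k * dx g (p.1 + k * h, p.2 + l * h) + l * dy g (p.1 + k * h, p.2 + l * h)) h := by
  have hray : HasDerivAt (fun h : ℝ => (p.1 + k * h, p.2 + l * h)) (k, l) h :=
    ((hasDerivAt_const_mul k).const_add p.1).prodMk ((hasDerivAt_const_mul l).const_add p.2)
  refine (hg.hasFDerivAt.comp_hasDerivAt (f := fun h : ℝ => (p.1 + k * h, p.2 + l * h)) h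
    hray).congr_deriv ?_
  have hkl : ((k, l) : ℝ × ℝ) = k • ((1 : ℝ), (0 : ℝ)) + l • ((0 : ℝ), (1 : ℝ)) := by simp
  rw [hkl, map_add, map_smul, map_smul, dx_eq_fderiv hg, dy_eq_fderiv hg, smul_eq_mul, smul_eq_mul]

theorem isBigO_comp_ray (hg : (fun q => g q - g p) =O[𝓝 p] fun q => q - p) :
    (fun h : ℝ => g (p.1 + k * h, p.2 + l * h) - g p) =O[𝓝 0] fun h => h := by
  refine (hg.comp_tendsto (tendsto_ray k l p)).trans
    (Asymptotics.IsBigO.of_bound ‖((k, l) : ℝ × ℝ)‖ (Eventually.of_forall fun h => ?_))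
  have hsmul : (p.1 + k * h, p.2 + l * h) - p = h • ((k, l) : ℝ × ℝ) := by
    ext <;> simp [mul_comm]
  rw [Function.comp_apply, hsmul, norm_smul, mul_comm]

theorem isBigO_sub_taylorPoly (K : ℕ) (hg : ContDiffAt ℝ K g p)
    (hlip : ∀ m n, m + n = K →
      (fun q => pderiv m n g q - pderiv m n g p) =O[𝓝 p] fun q => q - p) :
    (fun h : ℝ => g (p.1 + k * h, p.2 + l * h) - taylorPoly K (jetAt g p) (k * h) (l * h))
      =O[𝓝 0] fun h => h ^ (K + 1) := by
  induction K generalizing g with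
  | zero =>
    simpa [taylorPoly, sum_Lam, jetAt, pderiv] using isBigO_comp_ray k l (hlip 0 0 rfl)
  | succ K ih =>
    have hcomm : ∀ m n, m + n = K → pderiv m n (dx g) =ᶠ[𝓝 p] pderiv (m + 1) n g :=
      fun m n hmn => pderiv_dx m n (contDiffAt_of_nat_le hg (by omega))
    have hx := ih (contDiffAt_dx hg) fun m n hmn =>
      (hlip (m + 1) n (by omega)).congr'
        ((hcomm m n hmn).symm.sub (by rw [(hcomm m n hmn).eq_of_nhds])) EventuallyEq.rfl
    have hy := ih (contDiffAt_dy hg) fun m n hmn => hlip m (n + 1) (by omega)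
    refine isBigO_pow_succ_of_hasDerivAt ?_ ?_ ((hx.const_mul_left k).add (hy.const_mul_left l))
    · simp only [mul_zero, add_zero, taylorPoly_origin]
      exact sub_self _
    filter_upwards [(tendsto_ray k l p).eventually (eventually_differentiableAt hg)] with h hh
    have hT := hasDerivAt_taylorPoly K (jetAt g p) (hasDerivAt_const_mul (x := h) k)
      (hasDerivAt_const_mul l)
    have hdx : taylorPoly K (jetAt (dx g) p) = taylorPoly K fun i j => jetAt g p (i + 1) j :=
      taylorPoly_congr fun i j hij => jetAt_dx i (contDiffAt_of_nat_le hg (by omega))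
    have hdy : taylorPoly K (jetAt (dy g) p) = taylorPoly K fun i j => jetAt g p i (j + 1) := rfl
    refine ((hasDerivAt_comp_ray k l hh).sub hT).congr_deriv ?_
    rw [hdx, hdy]
    ring

theorem isBigO_sub_taylorPoly_of_contDiffAt (K : ℕ) (hg : ContDiffAt ℝ (K + 1 : ℕ) g p) :
    (fun h : ℝ => g (p.1 + k * h, p.2 + l * h) - taylorPoly K (jetAt g p) (k * h) (l * h))
      =O[𝓝 0] fun h => h ^ (K + 1) :=
  isBigO_sub_taylorPoly k l K (contDiffAt_of_nat_le hg (Nat.le_succ K)) fun m n hmn =>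
    ((contDiffAt_pderiv (n := 1) m n
      (contDiffAt_of_nat_le hg (by omega))).differentiableAt (by simp)).isBigO_sub

end TaylorRay

/-! ### The recursion for the jet of a solution -/

section Recursion

variable {α U V : ℕ → ℕ → ℝ} {m n : ℕ}

theorem leib_eq_add (A B : ℕ → ℕ → ℝ) (m n : ℕ) :
    leib A B m n = A 0 0 * B m n + leib (fun i j => if i + j = 0 then 0 else A i j) B m n := by
  simp only [leib, Finset.sum_range_succ', Nat.choose_zero_right, Nat.cast_one, mul_one, tsub_zero,
    one_mul, Nat.add_eq_zero_iff, ite_mul, zero_mul, mul_ite, mul_zero, one_ne_zero, and_false,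
    ↓reduceIte, and_true, add_zero]
  ring

theorem leib_eq_of_lower_eq_zero (A : ℕ → ℕ → ℝ) {B : ℕ → ℕ → ℝ}
    (hB : ∀ i j, i + j < m + n → B i j = 0) : leib A B m n = A 0 0 * B m n := by
  rw [leib_eq_add, add_eq_left]
  refine Finset.sum_eq_zero fun i hi => Finset.sum_eq_zero fun j hj => ?_
  rw [Finset.mem_range] at hi hj
  dsimp only
  split_ifs with hij
  · rw [zero_mul, mul_zero]
  · rw [hB _ _ (by omega), mul_zero, mul_zero]

theorem divGradJet_of_lower_eq_zero (α : ℕ → ℕ → ℝ) (hU : ∀ i j, i + j < m + n + 2 → U i j = 0) :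
    divGradJet α U m n = α 0 0 * (U (m + 2) n + U m (n + 2)) := by
  rw [divGradJet_apply, leib_eq_of_lower_eq_zero α fun i j hij => by
      rw [hU (i + 2) j (by omega), hU i (j + 2) (by omega), add_zero],
    leib_eq_of_lower_eq_zero _ fun i j hij => hU (i + 1) j (by omega),
    leib_eq_of_lower_eq_zero _ fun i j hij => hU i (j + 1) (by omega),
    hU (m + 1) n (by omega), hU m (n + 1) (by omega), mul_zero, mul_zero, add_zero, add_zero]

theorem divGradJet_solJet (hα : α 0 0 ≠ 0) (v φ : ℕ → ℕ → ℝ) (m n : ℕ) :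
    divGradJet α (solJet α v φ) m n = -φ m n := by
  have hrec : α 0 0 * solJet α v φ (m + 2) n = -(φ m n + α 0 0 * solJet α v φ m (n + 2)
      + (leib (fun i j => if i + j = 0 then 0 else α i j)
          (fun i j => solJet α v φ (i + 2) j + solJet α v φ i (j + 2)) m n
        + leib (fun i j => α (i + 1) j) (fun i j => solJet α v φ (i + 1) j) m n
        + leib (fun i j => α i (j + 1)) (fun i j => solJet α v φ i (j + 1)) m n)) := by
    rw [solJet, neg_mul, mul_neg, mul_inv_cancel_left₀ hα, add_assoc (φ m n + _),
      add_assoc (leib _ _ m n)]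
    simp only [leib, Finset.sum_range, dite_eq_ite, ite_mul, zero_mul, ← Finset.sum_add_distrib]
    refine congrArg (fun r => -(_ + r)) <|
      Finset.sum_congr rfl fun i _ => Finset.sum_congr rfl fun j _ => ?_
    rw [Nat.sub_add_comm (Nat.le_of_lt_succ i.2), Nat.sub_add_comm (Nat.le_of_lt_succ i.2),
      Nat.sub_add_comm (Nat.le_of_lt_succ j.2), Nat.sub_add_comm (Nat.le_of_lt_succ j.2)]
    ring
  rw [divGradJet_apply, leib_eq_add α]
  linear_combination hrec

theorem solJet_of_le_one (α v φ : ℕ → ℕ → ℝ) (hm : m ≤ 1) (n : ℕ) :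
    solJet α v φ m n = v m n := by
  interval_cases m <;> rw [solJet]

theorem jet_eq_zero (hα : α 0 0 ≠ 0) {K : ℕ} (h1 : ∀ m n, m ≤ 1 → m + n ≤ K → U m n = 0)
    (heq : ∀ m n, m + n + 2 ≤ K → divGradJet α U m n = 0) (m n : ℕ) (hmn : m + n ≤ K) :
    U m n = 0 := by
  induction hs : m + n using Nat.strong_induction_on generalizing m n with
  | _ s ihs =>
    subst hs
    induction m using Nat.strong_induction_on generalizing n with
    | _ m ihm =>
      rcases Nat.lt_or_ge 1 m with hm | hm
      · obtain ⟨m, rfl⟩ := Nat.exists_eq_add_of_le' hm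
        have hlead := divGradJet_of_lower_eq_zero α (U := U) (m := m) (n := n)
          fun i j hij => ihs (i + j) (by omega) i j (by omega) rfl
        have hU : U m (n + 2) = 0 := ihm m (by omega) (n + 2) (by omega) fun s hs i j hij h =>
          ihs s (by omega) i j hij h
        rw [heq m n (by omega), hU, add_zero] at hlead
        exact (mul_eq_zero.1 hlead.symm).resolve_left hα
      · exact h1 m n hm hmn

theorem jet_unique (hα : α 0 0 ≠ 0) {K : ℕ} (h1 : ∀ m n, m ≤ 1 → m + n ≤ K → U m n = V m n)
    (heq : ∀ m n, m + n + 2 ≤ K → divGradJet α U m n = divGradJet α V m n)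
    (hmn : m + n ≤ K) : U m n = V m n :=
  sub_eq_zero.1 <| jet_eq_zero (U := U - V) hα (fun i j hi hij => sub_eq_zero.2 (h1 i j hi hij))
    (fun i j hij => by rw [map_sub]; exact sub_eq_zero.2 (heq i j hij)) m n hmn

theorem mem_LamV1 {K : ℕ} {μ : ℕ × ℕ} : μ ∈ LamV1 K ↔ μ.1 + μ.2 ≤ K ∧ μ.1 ≤ 1 := by
  rw [LamV1, Finset.mem_filter, mem_Lam]

theorem mem_LamV2 {K : ℕ} {μ : ℕ × ℕ} : μ ∈ LamV2 K ↔ μ.1 + μ.2 ≤ K ∧ 2 ≤ μ.1 := by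
  rw [LamV2, Finset.mem_sdiff, mem_Lam, mem_LamV1]
  omega

theorem sum_mul_unitJet (s : Finset (ℕ × ℕ)) (F : ℕ → ℕ → ℝ) (h : (m, n) ∈ s) :
    ∑ μ ∈ s, F μ.1 μ.2 * unitJet μ.1 μ.2 m n = F m n := by
  simp only [unitJet, ← Prod.mk.injEq, Prod.mk.eta, mul_ite, mul_one, mul_zero,
    Finset.sum_ite_eq, h, if_true]

theorem jet_eq_sum {φ : ℕ → ℕ → ℝ} (hα : α 0 0 ≠ 0) {k : ℕ}
    (heq : ∀ m n, m + n ≤ k → divGradJet α U m n = -φ m n) (hmn : m + n ≤ k + 2) :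
    U m n = ∑ μ ∈ LamV1 (k + 2), U μ.1 μ.2 * AVu α m n μ.1 μ.2
      + ∑ μ ∈ Lam k, φ μ.1 μ.2 * AVf α m n μ.1 μ.2 := by
  have hunique : U m n = (∑ μ ∈ LamV1 (k + 2), U μ.1 μ.2 • solJet α (unitJet μ.1 μ.2) 0
      + ∑ μ ∈ Lam k, φ μ.1 μ.2 • solJet α 0 (unitJet μ.1 μ.2)) m n := by
    refine jet_unique hα (fun i j hi hij => ?_) (fun i j hij => ?_) hmn
    · simp only [Pi.add_apply, Finset.sum_apply, Pi.smul_apply, smul_eq_mul,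
        solJet_of_le_one _ _ _ hi, Pi.zero_apply, mul_zero, Finset.sum_const_zero, add_zero]
      exact (sum_mul_unitJet _ _ (mem_LamV1.2 ⟨hij, hi⟩)).symm
    · simp only [map_add, map_sum, map_smul, Pi.add_apply, Finset.sum_apply, Pi.smul_apply,
        smul_eq_mul, divGradJet_solJet hα, Pi.zero_apply, neg_zero, mul_zero, mul_neg,
        Finset.sum_const_zero, Finset.sum_neg_distrib, zero_add]
      rw [heq i j (by omega), sum_mul_unitJet _ _ (mem_Lam.2 (by omega : i + j ≤ k))]
  simpa only [AVu, AVf, Pi.add_apply, Finset.sum_apply, Pi.smul_apply, smul_eq_mul] using hunique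

end Recursion

/-! ### The leading parts of `G` and `Q` -/

section LeadingPart

/-- The jet of `harmPoly S b`: the derivatives of order `S` are `1` at `(b, S - b)` and then
alternate in sign along `(b + 2, S - b - 2)`, `(b + 4, S - b - 4)`, and so on. -/
noncomputable def harmJet (S b m n : ℕ) : ℝ :=
  if m + n = S ∧ b ≤ m ∧ Even (m - b) then (-1) ^ ((m - b) / 2) else 0

/-- The homogeneous polynomial of degree `S` with jet `harmJet S b`. It is harmonic for `b ≤ 1`;
in general its Laplacian is `x ^ (b - 2) * y ^ (S - b) / ((b - 2)! * (S - b)!)`. -/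
noncomputable def harmPoly (S b : ℕ) (x y : ℝ) : ℝ :=
  ∑ l ∈ Finset.range ((S - b) / 2 + 1), (-1) ^ l * x ^ (b + 2 * l) * y ^ (S - b - 2 * l)
    / ((b + 2 * l).factorial * (S - b - 2 * l).factorial)

variable {α U : ℕ → ℕ → ℝ} {K S b m n : ℕ}

theorem harmJet_of_ne (h : m + n ≠ S) : harmJet S b m n = 0 :=
  if_neg fun hc => h hc.1

theorem harmJet_add (S b m n : ℕ) : harmJet S b (m + 2) n + harmJet S b m (n + 2)
    = if m + n + 2 = S ∧ b = m + 2 then 1 else 0 := by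
  have heven (hb : b ≤ m) : Even (m + 2 - b) ↔ Even (m - b) := by
    rw [Nat.sub_add_comm hb, Nat.even_add]
    simp
  unfold harmJet
  by_cases hS : m + n + 2 = S
  · rcases lt_trichotomy b (m + 2) with hb | rfl | hb
    · rcases Nat.lt_or_ge m b with hb' | hb'
      · obtain rfl : b = m + 1 := by omega
        rw [if_neg, if_neg, if_neg] <;> simp
      · rw [if_neg (c := _ ∧ b = m + 2) (by omega)]
        by_cases he : Even (m - b)
        · rw [if_pos ⟨by omega, by omega, (heven hb').2 he⟩, if_pos ⟨by omega, hb', he⟩,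
            show (m + 2 - b) / 2 = (m - b) / 2 + 1 by omega, pow_succ]
          ring
        · rw [if_neg fun h => he ((heven hb').1 h.2.2), if_neg fun h => he h.2.2, add_zero]
    · rw [if_pos ⟨by omega, le_rfl, by simp⟩, if_neg (by omega), if_pos ⟨hS, rfl⟩]
      simp
    · rw [if_neg (by omega), if_neg (by omega), if_neg (by omega), add_zero]
  · rw [if_neg (by omega), if_neg (by omega), if_neg (by omega), add_zero]

theorem divGradJet_smul_harmJet (α : ℕ → ℕ → ℝ) (c : ℝ) (h : m + n + 2 ≤ S) :
    divGradJet α (c • harmJet S b) m n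
      = α 0 0 * (c * if m + n + 2 = S ∧ b = m + 2 then 1 else 0) := by
  rw [map_smul, Pi.smul_apply, Pi.smul_apply, divGradJet_of_lower_eq_zero α fun i j hij =>
    harmJet_of_ne (by omega), harmJet_add, smul_eq_mul, mul_left_comm]

theorem harmJet_of_le_one (hb : b ≤ 1) (hm : m ≤ 1) (hbS : b ≤ S) :
    harmJet S b m n = unitJet b (S - b) m n := by
  rw [harmJet, unitJet]
  refine ite_congr (propext ⟨?_, ?_⟩) (fun h => ?_) fun _ => rfl
  · rintro ⟨hS, hbm, r, hr⟩
    omega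
  · rintro ⟨rfl, rfl⟩
    exact ⟨by omega, le_rfl, by simp⟩
  · rw [h.1, Nat.sub_self, Nat.zero_div, pow_zero]

theorem AVu_of_le (hα : α 0 0 ≠ 0) {m' n' : ℕ} (hm : m ≤ 1) (h : m' + n' ≤ m + n) :
    AVu α m' n' m n = harmJet (m + n) m m' n' := by
  rw [← one_smul ℝ (harmJet (m + n) m)]
  refine jet_unique (U := solJet α (unitJet m n) 0) hα (fun i j hi _ => ?_)
    (fun i j hij => ?_) h
  · rw [solJet_of_le_one _ _ _ hi, one_smul, harmJet_of_le_one hm hi (Nat.le_add_right m n),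
      Nat.add_sub_cancel_left]
  · rw [divGradJet_solJet hα, divGradJet_smul_harmJet α 1 hij, if_neg (by omega)]
    simp

theorem AVf_of_le (hα : α 0 0 ≠ 0) {m' n' : ℕ} (h : m' + n' ≤ m + n + 2) :
    AVf α m' n' m n = (-(α 0 0)⁻¹ • harmJet (m + n + 2) (m + 2)) m' n' := by
  refine jet_unique (U := solJet α 0 (unitJet m n)) hα (fun i j hi _ => ?_)
    (fun i j hij => ?_) h
  · rw [solJet_of_le_one _ _ _ hi, Pi.smul_apply, Pi.smul_apply, harmJet, if_neg (by omega)]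
    simp
  · have hiff : i + j + 2 = m + n + 2 ∧ m + 2 = i + 2 ↔ i = m ∧ j = n := by omega
    simp only [divGradJet_solJet hα, divGradJet_smul_harmJet α _ hij, unitJet, hiff]
    field_simp

theorem taylorPoly_smul (K : ℕ) (c : ℝ) (U : ℕ → ℕ → ℝ) (x y : ℝ) :
    taylorPoly K (c • U) x y = c * taylorPoly K U x y := by
  simp only [taylorPoly, Finset.mul_sum, Pi.smul_apply, smul_eq_mul, mul_assoc]

theorem taylorPoly_harmJet (hb : b ≤ S) (x y : ℝ) :
    taylorPoly S (harmJet S b) x y = harmPoly S b x y := by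
  refine (Finset.sum_of_injOn (fun l => (b + 2 * l, S - b - 2 * l)) (fun l _ l' _ h => ?_)
    (fun l hl => ?_) ?_ fun l hl => ?_).symm
  · simp only [Prod.mk.injEq] at h
    omega
  · rw [Finset.mem_coe, Finset.mem_range] at hl
    rw [Finset.mem_coe, mem_Lam]
    dsimp only
    omega
  · rintro ⟨i, j⟩ - hij
    have hzero : harmJet S b i j = 0 := by
      refine if_neg ?_
      rintro ⟨hS, hbi, r, hr⟩
      exact hij ⟨r, by rw [Finset.mem_coe, Finset.mem_range]; omega, by
        simp only [Prod.mk.injEq]; omega⟩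
    rw [hzero, zero_mul]
  · rw [Finset.mem_range] at hl
    rw [harmJet, if_pos ⟨by omega, by omega, by simp⟩,
      show (b + 2 * l - b) / 2 = l by omega]
    ring

theorem taylorPoly_eq_add_sum_LamV2 (hS : S ≤ K) (hU : ∀ i j, i ≤ 1 → S < i + j → U i j = 0)
    (x y : ℝ) :
    taylorPoly K U x y = taylorPoly S U x y + ∑ μ ∈ LamV2 K \ LamV2 S,
      U μ.1 μ.2 * (x ^ μ.1 * y ^ μ.2 / (μ.1.factorial * μ.2.factorial)) := by
  have hSK : Lam S ⊆ Lam K := fun μ hμ => mem_Lam.2 ((mem_Lam.1 hμ).trans hS)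
  rw [taylorPoly, taylorPoly, ← Finset.sum_sdiff hSK, add_comm]
  congr 1
  refine (Finset.sum_subset (fun μ hμ => ?_) fun μ hμ hμ' => ?_).symm
  · simp only [Finset.mem_sdiff, mem_Lam, mem_LamV2] at hμ ⊢
    omega
  · simp only [Finset.mem_sdiff, mem_Lam, mem_LamV2] at hμ hμ'
    rw [hU μ.1 μ.2 (by omega) (by omega), zero_mul]

theorem taylorPoly_solJet_unitJet (hα : α 0 0 ≠ 0) (hm : m ≤ 1) (x y : ℝ) :
    taylorPoly (m + n) (solJet α (unitJet m n) 0) x y = harmPoly (m + n) m x y := by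
  rw [taylorPoly_congr (U := solJet α (unitJet m n) 0) fun i j hij => AVu_of_le hα hm hij,
    taylorPoly_harmJet (Nat.le_add_right m n)]

theorem taylorPoly_solJet_zero_unitJet (hα : α 0 0 ≠ 0) (x y : ℝ) :
    taylorPoly (m + n + 2) (solJet α 0 (unitJet m n)) x y
      = -(α 0 0)⁻¹ * harmPoly (m + n + 2) (m + 2) x y := by
  rw [taylorPoly_congr (U := solJet α 0 (unitJet m n)) fun i j hij => AVf_of_le hα hij,
    taylorPoly_smul, taylorPoly_harmJet (by omega)]

theorem GV_eq_taylorPoly (hα : α 0 0 ≠ 0) {M : ℕ} (hm : m ≤ 1) (hmn : m + n ≤ M + 1) (x y : ℝ) :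
    GV α M m n x y = taylorPoly (M + 1) (solJet α (unitJet m n) 0) x y := by
  have hU : ∀ i j, i ≤ 1 → m + n < i + j → solJet α (unitJet m n) 0 i j = 0 := fun i j hi hij => by
    rw [solJet_of_le_one _ _ _ hi, unitJet, if_neg (by omega)]
  rw [taylorPoly_eq_add_sum_LamV2 hmn hU, taylorPoly_solJet_unitJet hα hm]
  simp only [GV, AVu, harmPoly, Nat.add_sub_cancel_left]

theorem QV_eq_taylorPoly (hα : α 0 0 ≠ 0) {M : ℕ} (hmn : m + n + 2 ≤ M + 1) (x y : ℝ) :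
    QV α M m n x y = taylorPoly (M + 1) (solJet α 0 (unitJet m n)) x y := by
  have hU : ∀ i j, i ≤ 1 → m + n + 2 < i + j → solJet α 0 (unitJet m n) i j = 0 :=
    fun i j hi _ => solJet_of_le_one _ _ _ hi j
  rw [taylorPoly_eq_add_sum_LamV2 hmn hU, taylorPoly_solJet_zero_unitJet hα, QV]
  simp only [AVf]
  congr 1
  rw [show Finset.Icc 1 (1 + n / 2) = Finset.Ico (0 + 1) (n / 2 + 1 + 1) by ext; simp; omega,
    ← Finset.sum_Ico_add', harmPoly, Finset.mul_sum, show m + n + 2 - (m + 2) = n by omega,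
    Finset.range_eq_Ico]
  refine Finset.sum_congr rfl fun l _ => ?_
  rw [show m + 2 + 2 * l = m + 2 * (l + 1) by ring, show n + 2 - 2 * (l + 1) = n - 2 * l by omega,
    pow_succ]
  ring

theorem tendsto_pow_div_pow {d : ℕ} (hd : S ≤ d) :
    Tendsto (fun t : ℝ => t ^ d / t ^ S) (𝓝[>] 0) (𝓝 (if d = S then 1 else 0)) := by
  have hlim : Tendsto (fun t : ℝ => t ^ (d - S)) (𝓝[>] 0) (𝓝 (if d = S then 1 else 0)) := by
    refine (Continuous.tendsto' (by fun_prop) 0 _ ?_).mono_left nhdsWithin_le_nhds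
    rw [zero_pow_eq]
    exact if_congr (by omega) rfl rfl
  refine hlim.congr' ?_
  filter_upwards [self_mem_nhdsWithin] with t ht
  rw [div_eq_mul_inv, pow_sub₀ t (ne_of_gt ht) hd]

theorem tendsto_taylorPoly_div (hS : S ≤ K) (hU : ∀ i j, i + j < S → U i j = 0) (x y : ℝ) :
    Tendsto (fun h => taylorPoly K U (x * h) (y * h) / h ^ S) (𝓝[>] 0)
      (𝓝 (taylorPoly S U x y)) := by
  have hlim : taylorPoly S U x y = ∑ μ ∈ Lam K,
      U μ.1 μ.2 * (x ^ μ.1 * y ^ μ.2 / (μ.1.factorial * μ.2.factorial))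
        * if μ.1 + μ.2 = S then 1 else 0 := by
    simp only [mul_ite, mul_one, mul_zero, ← Finset.sum_filter]
    refine (Finset.sum_subset_zero_on_sdiff (fun μ hμ => ?_) (fun μ hμ => ?_) fun _ _ => rfl).symm
    · exact mem_Lam.2 (Finset.mem_filter.1 hμ).2.le
    · simp only [Finset.mem_sdiff, Finset.mem_filter, mem_Lam] at hμ
      rw [hU μ.1 μ.2 (by omega), zero_mul]
  rw [hlim]
  simp only [taylorPoly, Finset.sum_div]
  refine tendsto_finsetSum _ fun μ _ => ?_
  rcases lt_or_ge (μ.1 + μ.2) S with hμ | hμ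
  · simp [hU _ _ hμ]
  · refine ((tendsto_pow_div_pow hμ).const_mul _).congr fun t => ?_
    rw [mul_pow, mul_pow, pow_add]
    ring

end LeadingPart

/-! ### Weights that annihilate harmonic polynomials -/

section NinePointWeights

/-- The weights of the nine-point Laplacian: `-20` at the centre, `4` at the edge midpoints and
`1` at the corners. -/
noncomputable def ninePointWeight (k l : ℝ) : ℝ :=
  -20 + 24 * (k ^ 2 + l ^ 2) - 27 * (k ^ 2 * l ^ 2)

variable {x : ℤ → ℤ → ℝ}

theorem sum_stIdx {E : Type*} [AddCommMonoid E] (F : ℤ → E) :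
    ∑ k ∈ stIdx, F k = F (-1) + (F 0 + F 1) := by
  have h : stIdx = {-1, 0, 1} := by decide
  rw [h, Finset.sum_insert (by decide), Finset.sum_pair (by decide)]

theorem forall_stIdx {P : ℤ → Prop} : (∀ k ∈ stIdx, P k) ↔ P (-1) ∧ P 0 ∧ P 1 := by
  have h : stIdx = {-1, 0, 1} := by decide
  simp only [h, Finset.mem_insert, Finset.mem_singleton, forall_eq_or_imp, forall_eq]

theorem eq_mul_ninePointWeight (h : ∀ m n, m ≤ 1 → m + n ≤ 4 →
      ∑ k ∈ stIdx, ∑ l ∈ stIdx, x k l * harmPoly (m + n) m k l = 0) :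
    ∀ k ∈ stIdx, ∀ l ∈ stIdx, x k l = x 1 1 * ninePointWeight k l := by
  have h00 := h 0 0 (by norm_num) (by norm_num)
  have h01 := h 0 1 (by norm_num) (by norm_num)
  have h10 := h 1 0 (by norm_num) (by norm_num)
  have h02 := h 0 2 (by norm_num) (by norm_num)
  have h11 := h 1 1 (by norm_num) (by norm_num)
  have h03 := h 0 3 (by norm_num) (by norm_num)
  have h12 := h 1 2 (by norm_num) (by norm_num)
  have h04 := h 0 4 (by norm_num) (by norm_num)
  simp only [sum_stIdx, harmPoly, Finset.sum_range_succ, Finset.sum_range_zero, Nat.reduceAdd,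
    Nat.reduceSub, Nat.reduceDiv, Nat.reduceMul, Nat.factorial, Nat.cast_one, Int.cast_neg,
    Int.cast_one, Int.cast_zero] at h00 h01 h10 h02 h11 h03 h12 h04
  simp only [forall_stIdx, ninePointWeight, Int.cast_neg, Int.cast_one, Int.cast_zero]
  refine ⟨⟨?_, ?_, ?_⟩, ⟨?_, ?_, ?_⟩, ⟨?_, ?_, ?_⟩⟩ <;> linarith

theorem eq_zero_of_sum_mul_harmPoly_eq_zero {S b : ℕ} (h : ∀ m n, m ≤ 1 → m + n ≤ 4 →
      ∑ k ∈ stIdx, ∑ l ∈ stIdx, x k l * harmPoly (m + n) m k l = 0)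
    (hw : ∑ k ∈ stIdx, ∑ l ∈ stIdx, ninePointWeight k l * harmPoly S b k l ≠ 0)
    (hS : ∑ k ∈ stIdx, ∑ l ∈ stIdx, x k l * harmPoly S b k l = 0) :
    ∀ k ∈ stIdx, ∀ l ∈ stIdx, x k l = 0 := by
  have hx := eq_mul_ninePointWeight h
  have hsum : ∑ k ∈ stIdx, ∑ l ∈ stIdx, x k l * harmPoly S b k l
      = x 1 1 * ∑ k ∈ stIdx, ∑ l ∈ stIdx, ninePointWeight k l * harmPoly S b k l := by
    simp only [Finset.mul_sum, ← mul_assoc]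
    exact Finset.sum_congr rfl fun k hk => Finset.sum_congr rfl fun l hl => by rw [← hx k hk l hl]
  have h11 : x 1 1 = 0 := (mul_eq_zero.1 (hsum.symm.trans hS)).resolve_right hw
  intro k hk l hl
  rw [hx k hk l hl, h11, zero_mul]

theorem sum_ninePointWeight_mul_harmPoly_two :
    ∑ k ∈ stIdx, ∑ l ∈ stIdx, ninePointWeight k l * harmPoly 2 2 k l = 6 := by
  norm_num [sum_stIdx, harmPoly, ninePointWeight]

/- The degree-eight harmonic polynomial `Re (x + iy) ^ 8 / 8!` is the first one that the nine-point
Laplacian does not annihilate. -/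
theorem sum_ninePointWeight_mul_harmPoly_eight :
    ∑ k ∈ stIdx, ∑ l ∈ stIdx, ninePointWeight k l * harmPoly 8 0 k l = 1 / 504 := by
  norm_num [sum_stIdx, harmPoly, ninePointWeight, Finset.sum_range_succ, Nat.factorial]

end NinePointWeights

/-! ### Consistency of the schemes -/

section Consistency

variable {α U φ : ℕ → ℕ → ℝ} {a u f : ℝ × ℝ → ℝ} {p : ℝ × ℝ} {K M S m n : ℕ}
  {c : ℤ → ℤ → ℕ → ℝ} {C : ℤ → ℤ → ℝ → ℝ}

theorem taylorPoly_eq_sum (hα : α 0 0 ≠ 0)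
    (hU : ∀ m n, m + n ≤ M → divGradJet α U m n = -φ m n) (x y : ℝ) :
    taylorPoly (M + 2) U x y = ∑ μ ∈ LamV1 (M + 2), U μ.1 μ.2 * GV α (M + 1) μ.1 μ.2 x y
      + ∑ μ ∈ Lam M, φ μ.1 μ.2 * QV α (M + 1) μ.1 μ.2 x y := by
  have hG : ∀ μ ∈ LamV1 (M + 2), U μ.1 μ.2 * GV α (M + 1) μ.1 μ.2 x y = ∑ ν ∈ Lam (M + 2),
      U μ.1 μ.2 * AVu α ν.1 ν.2 μ.1 μ.2
        * (x ^ ν.1 * y ^ ν.2 / (ν.1.factorial * ν.2.factorial)) := by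
    intro μ hμ
    rw [GV_eq_taylorPoly hα (mem_LamV1.1 hμ).2 (mem_LamV1.1 hμ).1, taylorPoly, Finset.mul_sum]
    simp only [AVu, mul_assoc]
  have hQ : ∀ μ ∈ Lam M, φ μ.1 μ.2 * QV α (M + 1) μ.1 μ.2 x y = ∑ ν ∈ Lam (M + 2),
      φ μ.1 μ.2 * AVf α ν.1 ν.2 μ.1 μ.2
        * (x ^ ν.1 * y ^ ν.2 / (ν.1.factorial * ν.2.factorial)) := by
    intro μ hμ
    rw [QV_eq_taylorPoly hα (Nat.add_le_add_right (mem_Lam.1 hμ) 2), taylorPoly, Finset.mul_sum]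
    simp only [AVf, mul_assoc]
  rw [Finset.sum_congr rfl hG, Finset.sum_congr rfl hQ, Finset.sum_comm,
    Finset.sum_comm (s := Lam M), ← Finset.sum_add_distrib, taylorPoly]
  refine Finset.sum_congr rfl fun ν hν => ?_
  rw [jet_eq_sum hα hU (mem_Lam.1 hν), add_mul, Finset.sum_mul, Finset.sum_mul]

theorem tendsto_polyCoeff (M : ℕ) (c : ℤ → ℤ → ℕ → ℝ) (k l : ℤ) :
    Tendsto (polyCoeff M c k l) (𝓝[>] 0) (𝓝 (c k l 0)) := by
  refine (Continuous.tendsto' ?_ 0 _ ?_).mono_left nhdsWithin_le_nhds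
  · unfold polyCoeff
    fun_prop
  · simp [polyCoeff, Finset.sum_range_succ']

theorem truncError_eq (hα : α 0 0 ≠ 0)
    (hU : ∀ m n, m + n ≤ M → divGradJet α U m n = -jetAt f p m n) (h : ℝ) :
    truncError M (polyCoeff (M + 1) c) (rhsCoeff α (M + 1) c) p u f h
      = ∑ k ∈ stIdx, ∑ l ∈ stIdx, polyCoeff (M + 1) c k l h *
          (u (stPt p h k l) - taylorPoly (M + 2) U (k * h) (l * h))
        + ∑ μ ∈ LamV1 (M + 2), U μ.1 μ.2 * ∑ k ∈ stIdx, ∑ l ∈ stIdx,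
          polyCoeff (M + 1) c k l h * GV α (M + 1) μ.1 μ.2 (k * h) (l * h) := by
  have hsum : ∑ k ∈ stIdx, ∑ l ∈ stIdx,
        polyCoeff (M + 1) c k l h * taylorPoly (M + 2) U (k * h) (l * h)
      = ∑ μ ∈ LamV1 (M + 2), U μ.1 μ.2 * ∑ k ∈ stIdx, ∑ l ∈ stIdx,
          polyCoeff (M + 1) c k l h * GV α (M + 1) μ.1 μ.2 (k * h) (l * h)
        + ∑ μ ∈ Lam M, pderiv μ.1 μ.2 f p * rhsCoeff α (M + 1) c μ.1 μ.2 h := by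
    simp only [taylorPoly_eq_sum hα hU, rhsCoeff, mul_add, Finset.mul_sum, Finset.sum_add_distrib,
      Finset.sum_comm (s := stIdx) (t := LamV1 (M + 2)), Finset.sum_comm (s := stIdx) (t := Lam M),
      mul_left_comm (polyCoeff _ _ _ _ _)]
    rfl
  simp only [truncError, stencilOp, mul_sub, Finset.sum_sub_distrib, hsum]
  ring

theorem isBigO_truncError (ha : ContDiffAt ℝ (M + 1 : ℕ) a p) (ha0 : a p ≠ 0)
    (hu : ContDiffAt ℝ (M + 2 : ℕ) u p)
    (hlip : ∀ m n, m + n = M + 2 →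
      (fun q => pderiv m n u q - pderiv m n u p) =O[𝓝 p] fun q => q - p)
    (hf : ellip a u =ᶠ[𝓝 p] f) (hc : SolvesSystem (jetAt a p) (M + 1) c) :
    truncError M (polyCoeff (M + 1) c) (rhsCoeff (jetAt a p) (M + 1) c) p u f
      =O[𝓝[>] 0] fun h : ℝ => h ^ (M + 3) := by
  have hjet : ∀ m n, m + n ≤ M → divGradJet (jetAt a p) (jetAt u p) m n = -jetAt f p m n := by
    intro m n hmn
    rw [jetAt, ← (pderiv_congr m n hf).eq_of_nhds, pderiv_ellip m n
      (contDiffAt_of_nat_le ha (by omega)) (contDiffAt_of_nat_le hu (by omega)), neg_neg]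
  simp only [funext (truncError_eq (u := u) (c := c) (α := jetAt a p) ha0 hjet)]
  refine Asymptotics.IsBigO.add
    (Asymptotics.IsBigO.fun_sum fun k _ => Asymptotics.IsBigO.fun_sum fun l _ => ?_)
    (Asymptotics.IsBigO.fun_sum fun μ hμ => (hc μ hμ).const_mul_left _)
  simpa only [stPt, one_mul] using ((tendsto_polyCoeff (M + 1) c k l).isBigO_one ℝ).mul
    ((isBigO_sub_taylorPoly k l (M + 2) hu hlip).mono nhdsWithin_le_nhds)

theorem tendsto_div_pow_of_isBigO {F : ℝ → ℝ} (hF : F =O[𝓝[>] 0] fun h => h ^ n) (hS : S < n) :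
    Tendsto (fun h => F h / h ^ S) (𝓝[>] 0) (𝓝 0) := by
  have hdiv := hF.mul (Asymptotics.isBigO_refl (fun h : ℝ => (h ^ S)⁻¹) (𝓝[>] 0))
  simp only [← div_eq_mul_inv] at hdiv
  exact hdiv.trans_tendsto (by simpa only [if_neg hS.ne'] using tendsto_pow_div_pow hS.le)

theorem tendsto_sum_mul_taylorPoly_div {x : ℤ → ℤ → ℝ}
    (hC : ∀ k l, Tendsto (C k l) (𝓝[>] 0) (𝓝 (x k l))) (hS : S ≤ K)
    (hU : ∀ i j, i + j < S → U i j = 0) :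
    Tendsto (fun h => (∑ k ∈ stIdx, ∑ l ∈ stIdx, C k l h * taylorPoly K U (k * h) (l * h)) / h ^ S)
      (𝓝[>] 0) (𝓝 (∑ k ∈ stIdx, ∑ l ∈ stIdx, x k l * taylorPoly S U k l)) := by
  simp only [Finset.sum_div, mul_div_assoc]
  exact tendsto_finsetSum _ fun k _ => tendsto_finsetSum _ fun l _ =>
    (hC k l).mul (tendsto_taylorPoly_div hS hU k l)

theorem solJet_unitJet_of_lt (hα : α 0 0 ≠ 0) (hm : m ≤ 1) (i j : ℕ) (hij : i + j < m + n) :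
    solJet α (unitJet m n) 0 i j = 0 :=
  (AVu_of_le hα hm hij.le).trans (harmJet_of_ne hij.ne)

theorem solJet_zero_unitJet_of_lt (hα : α 0 0 ≠ 0) (i j : ℕ) (hij : i + j < m + n + 2) :
    solJet α 0 (unitJet m n) i j = 0 := by
  rw [← AVf, AVf_of_le hα hij.le, Pi.smul_apply, Pi.smul_apply, harmJet_of_ne hij.ne, smul_zero]

theorem sum_coeff_mul_harmPoly (hα : α 0 0 ≠ 0) (hc : SolvesSystem α M c) (hm : m ≤ 1)
    (hmn : m + n ≤ M + 1) :
    ∑ k ∈ stIdx, ∑ l ∈ stIdx, c k l 0 * harmPoly (m + n) m k l = 0 := by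
  have hlim := tendsto_sum_mul_taylorPoly_div (tendsto_polyCoeff M c) hmn
    (solJet_unitJet_of_lt hα hm)
  simp only [taylorPoly_solJet_unitJet hα hm, ← GV_eq_taylorPoly hα hm hmn] at hlim
  exact tendsto_nhds_unique hlim
    (tendsto_div_pow_of_isBigO (hc (m, n) (mem_LamV1.2 ⟨hmn, hm⟩)) (by omega))

/-- The limit of `C_{f,0,0}(h) / h ^ 2`: the constant `λ` of the theorem. -/
noncomputable def leadRhs (α : ℕ → ℕ → ℝ) (c : ℤ → ℤ → ℕ → ℝ) : ℝ :=
  -(α 0 0)⁻¹ * ∑ k ∈ stIdx, ∑ l ∈ stIdx, c k l 0 * harmPoly 2 2 k l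

theorem leadRhs_ne_zero (hα : α 0 0 ≠ 0) (hM : 3 ≤ M) (hc : SolvesSystem α M c)
    (hnt : Nontriv c) : leadRhs α c ≠ 0 := by
  obtain ⟨k, hk, l, hl, hkl⟩ := hnt
  refine mul_ne_zero (neg_ne_zero.2 (inv_ne_zero hα)) fun h0 => hkl ?_
  exact eq_zero_of_sum_mul_harmPoly_eq_zero (x := fun k l => c k l 0)
    (fun m n hm hmn => sum_coeff_mul_harmPoly hα hc hm (by omega))
    (by norm_num [sum_ninePointWeight_mul_harmPoly_two]) h0 k hk l hl

theorem tendsto_rhsCoeff_zero_div (hα : α 0 0 ≠ 0) (hM : 1 ≤ M) (c : ℤ → ℤ → ℕ → ℝ) :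
    Tendsto (fun h => rhsCoeff α M c 0 0 h / h ^ 2) (𝓝[>] 0) (𝓝 (leadRhs α c)) := by
  have hlim := tendsto_sum_mul_taylorPoly_div (tendsto_polyCoeff M c) (by omega : 0 + 0 + 2 ≤ M + 1)
    (solJet_zero_unitJet_of_lt (m := 0) (n := 0) hα)
  simp only [taylorPoly_solJet_zero_unitJet (m := 0) (n := 0) hα, mul_left_comm _ (-(α 0 0)⁻¹),
    ← Finset.mul_sum] at hlim
  simpa only [rhsCoeff, leadRhs, zero_add,
    QV_eq_taylorPoly (m := 0) (n := 0) hα (by omega : 0 + 0 + 2 ≤ M + 1)] using hlim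

theorem tendsto_rhsCoeff_div_of_pos (hα : α 0 0 ≠ 0) (hmn : m + n + 2 ≤ M + 1) (hpos : 0 < m + n)
    (c : ℤ → ℤ → ℕ → ℝ) :
    Tendsto (fun h => rhsCoeff α M c m n h / h ^ 2) (𝓝[>] 0) (𝓝 0) := by
  have hU : ∀ i j, i + j ≤ 2 → solJet α 0 (unitJet m n) i j = 0 := fun i j hij =>
    solJet_zero_unitJet_of_lt hα i j (by omega)
  have hlim := tendsto_sum_mul_taylorPoly_div (S := 2) (tendsto_polyCoeff M c)
    (by omega : 2 ≤ M + 1) fun i j hij => hU i j hij.le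
  have hzero (x y : ℝ) : taylorPoly 2 (solJet α 0 (unitJet m n)) x y = 0 :=
    Finset.sum_eq_zero fun μ hμ => by rw [hU _ _ (mem_Lam.1 hμ), zero_mul]
  simpa only [rhsCoeff, QV_eq_taylorPoly hα hmn, hzero, mul_zero, Finset.sum_const_zero] using hlim

theorem tendsto_stencilOp_div (hα : α 0 0 ≠ 0)
    (ht : truncError M (polyCoeff (M + 1) c) (rhsCoeff α (M + 1) c) p u f
      =O[𝓝[>] 0] fun h : ℝ => h ^ (M + 3)) :
    Tendsto (fun h : ℝ => stencilOp (polyCoeff (M + 1) c) p u h / h ^ 2) (𝓝[>] 0)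
      (𝓝 (leadRhs α c * f p)) := by
  have hrhs : Tendsto (fun h => ∑ μ ∈ Lam M,
      rhsCoeff α (M + 1) c μ.1 μ.2 h / h ^ 2 * pderiv μ.1 μ.2 f p) (𝓝[>] 0)
      (𝓝 (∑ μ ∈ Lam M, if μ = (0, 0) then leadRhs α c * f p else 0)) := by
    refine tendsto_finsetSum _ fun μ hμ => ?_
    have hμM := mem_Lam.1 hμ
    split_ifs with h0
    · subst h0
      exact (tendsto_rhsCoeff_zero_div hα (by omega) c).mul_const _
    · have hpos : 0 < μ.1 + μ.2 := Nat.pos_of_ne_zero fun h => h0 (by ext <;> dsimp only <;> omega)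
      simpa only [zero_mul] using
        (tendsto_rhsCoeff_div_of_pos hα (by omega) hpos c).mul_const (pderiv μ.1 μ.2 f p)
  rw [Finset.sum_ite_eq', if_pos (mem_Lam.2 (Nat.zero_le M))] at hrhs
  rw [← zero_add (_ * f p)]
  refine ((tendsto_div_pow_of_isBigO (S := 2) ht (by omega)).add hrhs).congr fun h => ?_
  simp only [truncError, div_mul_eq_mul_div, mul_comm (rhsCoeff _ _ _ _ _ _), ← Finset.sum_div]
  ring

end Consistency

/-! ### The bound on the accuracy order -/

section OrderBound

theorem tendsto_zero_of_tendsto_mulVec {ι m n : Type*} [Finite m] [Fintype n]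
    {l : Filter ι} {A : Matrix m n ℝ} (hA : Function.Injective A.mulVec) {T : ι → Matrix m n ℝ}
    (hT : Tendsto T l (𝓝 A)) {x : ι → n → ℝ} (hx : Tendsto (fun i => (T i).mulVec (x i)) l (𝓝 0)) :
    Tendsto x l (𝓝 0) := by
  classical
  have := Fintype.ofFinite m
  let G (S : Matrix m n ℝ) : Matrix n n ℝ := A.transpose * S
  have hG : Continuous G := continuous_const.matrix_mul continuous_id
  have hGT : Tendsto (fun i => G (T i)) l (𝓝 (G A)) := (hG.tendsto A).comp hT
  have hdet : (G A).det ≠ 0 := by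
    rw [← isUnit_iff_ne_zero, ← Matrix.isUnit_iff_isUnit_det, ← Matrix.mulVec_injective_iff_isUnit]
    exact LinearMap.ker_eq_bot.1
      ((Matrix.ker_mulVecLin_transpose_mul_self A).trans (LinearMap.ker_eq_bot.2 hA))
  have hdetx : Tendsto (fun i => (G (T i)).det • x i) l (𝓝 0) := by
    have hcont : Continuous fun z : Matrix n n ℝ × (m → ℝ) =>
        z.1.adjugate.mulVec (A.transpose.mulVec z.2) :=
      continuous_fst.matrix_adjugate.matrix_mulVec (continuous_const.matrix_mulVec continuous_snd)
    have hlim := (hcont.tendsto (G A, 0)).comp (hGT.prodMk_nhds hx)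
    simp only [Matrix.mulVec_zero] at hlim
    refine hlim.congr fun i => ?_
    simp only [Function.comp_apply, Matrix.mulVec_mulVec, G]
    rw [Matrix.mul_assoc, Matrix.adjugate_mul, Matrix.smul_mulVec, Matrix.one_mulVec]
  have hdetT : Tendsto (fun i => (G (T i)).det) l (𝓝 (G A).det) :=
    (continuous_id.matrix_det.tendsto (G A)).comp hGT
  have hlim := (hdetT.inv₀ hdet).smul hdetx
  rw [smul_zero] at hlim
  refine hlim.congr' ?_
  filter_upwards [hdetT.eventually_ne hdet] with i hi
  rw [inv_smul_smul₀ hi]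

theorem tendsto_zero_of_unisolvent {ι κ ν : Type*} {l : Filter ι} {s : Finset κ} {r : Finset ν}
    {A : ν → κ → ℝ} (hA : ∀ x : κ → ℝ, (∀ j ∈ r, ∑ k ∈ s, x k * A j k = 0) → ∀ k ∈ s, x k = 0)
    {T : ι → ν → κ → ℝ} (hT : ∀ j ∈ r, ∀ k ∈ s, Tendsto (fun i => T i j k) l (𝓝 (A j k)))
    {x : ι → κ → ℝ} (hx : ∀ j ∈ r, Tendsto (fun i => ∑ k ∈ s, x i k * T i j k) l (𝓝 0)) :
    ∀ k ∈ s, Tendsto (fun i => x i k) l (𝓝 0) := by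
  classical
  let A' : Matrix r s ℝ := fun j k => A j k
  have hA' : Function.Injective A'.mulVec := by
    refine (injective_iff_map_eq_zero A'.mulVecLin).2 fun y hy => ?_
    have hext (k : s) : Function.extend Subtype.val y 0 (k : κ) = y k :=
      Subtype.val_injective.extend_apply y 0 k
    refine funext fun k => (hext k).symm.trans (hA _ (fun j hj => ?_) k k.2)
    rw [← Finset.sum_coe_sort]
    simp only [hext]
    exact (Finset.sum_congr rfl fun k _ => mul_comm _ _).trans (congrFun hy ⟨j, hj⟩)
  have hx' : Tendsto (fun i (k : s) => x i k) l (𝓝 0) := by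
    refine tendsto_zero_of_tendsto_mulVec hA' (T := fun i j k => T i j k)
      (tendsto_pi_nhds.2 fun j => tendsto_pi_nhds.2 fun k => hT j j.2 k k.2)
      (tendsto_pi_nhds.2 fun j => (hx j j.2).congr fun i => ?_)
    rw [← Finset.sum_coe_sort]
    exact Finset.sum_congr rfl fun k _ => mul_comm _ _
  exact fun k hk => tendsto_pi_nhds.1 hx' ⟨k, hk⟩

variable {a : ℝ × ℝ → ℝ} {p : ℝ × ℝ} {N q : ℕ} {C : ℤ → ℤ → ℝ → ℝ} {F : ℕ → ℕ → ℝ → ℝ}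

theorem pderiv_ellip_polyAt_solJet {α : ℕ → ℕ → ℝ} {m n K : ℕ} (hα : α 0 0 ≠ 0)
    (ha : ContDiffAt ℝ (m + n + 1 : ℕ) a p)
    (hjet : ∀ i j, i + j ≤ m + n + 1 → jetAt a p i j = α i j) (hK : m + n + 2 ≤ K)
    (v φ : ℕ → ℕ → ℝ) : pderiv m n (ellip a (polyAt K (solJet α v φ) p)) p = φ m n := by
  rw [pderiv_ellip _ _ ha (contDiff_polyAt _ _ _).contDiffAt,
    divGradJet_congr hjet fun i j hij => jetAt_polyAt (by omega) _ _, divGradJet_solJet hα, neg_neg]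

theorem truncError_polyAt_solJet (ha : ContDiffAt ℝ (N + 1 : ℕ) a p) (ha0 : a p ≠ 0) {K : ℕ}
    (hK : N + 2 ≤ K) (v : ℕ → ℕ → ℝ) (h : ℝ) :
    truncError N C F p (polyAt K (solJet (jetAt a p) v 0) p)
        (ellip a (polyAt K (solJet (jetAt a p) v 0) p)) h
      = ∑ k ∈ stIdx, ∑ l ∈ stIdx,
          C k l h * taylorPoly K (solJet (jetAt a p) v 0) (k * h) (l * h) := by
  have hzero : ∀ μ ∈ Lam N,
      pderiv μ.1 μ.2 (ellip a (polyAt K (solJet (jetAt a p) v 0) p)) p = 0 := by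
    intro μ hμ
    have hμN := mem_Lam.1 hμ
    exact pderiv_ellip_polyAt_solJet ha0 (contDiffAt_of_nat_le ha (by omega)) (fun _ _ _ => rfl)
      (by omega) v 0
  rw [truncError, Finset.sum_eq_zero fun μ hμ => by rw [hzero μ hμ, zero_mul], sub_zero]
  simp only [stencilOp, polyAt, stPt, add_sub_cancel_left]

theorem eq_zero_of_annihilates_harmPoly {x : ℤ × ℤ → ℝ} (hx : ∀ μ ∈ LamV1 8,
      ∑ κ ∈ stIdx ×ˢ stIdx, x κ * harmPoly (μ.1 + μ.2) μ.1 κ.1 κ.2 = 0) :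
    ∀ κ ∈ stIdx ×ˢ stIdx, x κ = 0 := by
  have h (m n : ℕ) (hm : m ≤ 1) (hmn : m + n ≤ 8) :
      ∑ k ∈ stIdx, ∑ l ∈ stIdx, x (k, l) * harmPoly (m + n) m k l = 0 := by
    simpa only [Finset.sum_product] using hx (m, n) (mem_LamV1.2 ⟨hmn, hm⟩)
  have hw := sum_ninePointWeight_mul_harmPoly_eight.trans_ne (by norm_num : (1 / 504 : ℝ) ≠ 0)
  intro κ hκ
  obtain ⟨hk, hl⟩ := Finset.mem_product.1 hκ
  exact eq_zero_of_sum_mul_harmPoly_eq_zero (x := fun k l => x (k, l))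
    (fun m n hm hmn => h m n hm (by omega)) hw (h 0 8 (by norm_num) le_rfl) _ hk _ hl

theorem HasAccuracyOrder.le_six (ha0 : a p ≠ 0) (ha : ContDiffAt ℝ (N + 1 : ℕ) a p)
    (h : HasAccuracyOrder a p N C F q) : q ≤ 6 := by
  by_contra! hq
  have hα : jetAt a p 0 0 ≠ 0 := ha0
  let U (μ : ℕ × ℕ) : ℕ → ℕ → ℝ := solJet (jetAt a p) (unitJet μ.1 μ.2) 0
  have hC : ∀ κ ∈ stIdx ×ˢ stIdx, Tendsto (fun h => C κ.1 κ.2 h) (𝓝[>] 0) (𝓝 0) := by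
    refine tendsto_zero_of_unisolvent (r := LamV1 8) (fun _ => eq_zero_of_annihilates_harmPoly)
      (T := fun h μ κ => taylorPoly (N + 10) (U μ) (κ.1 * h) (κ.2 * h) / h ^ (μ.1 + μ.2))
      (x := fun h κ => C κ.1 κ.2 h) (fun μ hμ κ _ => ?_) (fun μ hμ => ?_)
    all_goals obtain ⟨hμ8, hμ1⟩ := mem_LamV1.1 hμ
    · rw [← taylorPoly_solJet_unitJet hα hμ1]
      exact tendsto_taylorPoly_div (by omega) (solJet_unitJet_of_lt hα hμ1) _ _
    · have ht := h.2 (polyAt (N + 10) (U μ) p) (contDiff_polyAt _ _ _)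
      refine (tendsto_div_pow_of_isBigO (S := μ.1 + μ.2) ht (by omega)).congr fun h => ?_
      rw [truncError_polyAt_solJet ha ha0 (by omega), Finset.sum_product]
      simp only [Finset.sum_div, mul_div_assoc, U]
  exact h.1 fun k hk l hl => hC (k, l) (Finset.mk_mem_product hk hl)

end OrderBound

/-! ### Regular points -/

section RegularPoints

variable {Ω : Set (ℝ × ℝ)} {ψ a u f : ℝ × ℝ → ℝ} {p : ℝ × ℝ}

theorem eventually_stPt_mem {s : Set (ℝ × ℝ)} (hs : s ∈ 𝓝 p) :
    ∀ᶠ h in 𝓝[>] (0 : ℝ), ∀ k ∈ stIdx, ∀ l ∈ stIdx, stPt p h k l ∈ s :=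
  (eventually_all_finset _).2 fun k _ => (eventually_all_finset _).2 fun l _ =>
    ((tendsto_ray k l p).mono_left nhdsWithin_le_nhds).eventually hs

theorem isOpen_rect (l₁ l₂ l₃ l₄ : ℝ) : IsOpen (rect l₁ l₂ l₃ l₄) :=
  isOpen_Ioo.prod isOpen_Ioo

theorem omegaPlus_or_omegaMinus_mem_nhds (hΩ : IsOpen Ω) (hψ : ContinuousOn ψ Ω)
    (hp : p ∈ Ω \ interface Ω ψ) : omegaPlus Ω ψ ∈ 𝓝 p ∨ omegaMinus Ω ψ ∈ 𝓝 p := by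
  have hn := hΩ.mem_nhds hp.1
  have hc := hψ.continuousAt hn
  rcases lt_trichotomy (ψ p) 0 with hneg | hzero | hpos
  · exact Or.inr (inter_mem hn (hc.eventually (gt_mem_nhds hneg)))
  · exact absurd ⟨hp.1, hzero⟩ hp.2
  · exact Or.inl (inter_mem hn (hc.eventually (lt_mem_nhds hpos)))

theorem eventually_isRegularPoint (hp : omegaPlus Ω ψ ∈ 𝓝 p ∨ omegaMinus Ω ψ ∈ 𝓝 p) :
    ∀ᶠ h in 𝓝[>] (0 : ℝ), IsRegularPoint ψ p h := by
  rcases hp with hp | hp <;> filter_upwards [eventually_stPt_mem hp] with h hst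
  · exact Or.inr (eq_empty_of_forall_notMem fun κ hκ => lt_asymm (hst _ hκ.1 _ hκ.2.1).2 hκ.2.2)
  · exact Or.inl (eq_empty_of_forall_notMem fun κ hκ => hκ.2.2.not_gt (hst _ hκ.1 _ hκ.2.1).2)

theorem IsCoefficient.contDiffAt (ha : IsCoefficient Ω ψ a)
    (hp : omegaPlus Ω ψ ∈ 𝓝 p ∨ omegaMinus Ω ψ ∈ 𝓝 p) : ContDiffAt ℝ (6 : ℕ) a p :=
  hp.elim ha.smooth_plus.contDiffAt ha.smooth_minus.contDiffAt

theorem IsCoefficient.pos (ha : IsCoefficient Ω ψ a)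
    (hp : omegaPlus Ω ψ ∈ 𝓝 p ∨ omegaMinus Ω ψ ∈ 𝓝 p) : 0 < a p :=
  hp.elim (fun h => ha.pos_plus p (mem_of_mem_nhds h)) fun h => ha.pos_minus p (mem_of_mem_nhds h)

theorem IsSolution.contDiffAt (hu : IsSolution Ω ψ a u f)
    (hp : omegaPlus Ω ψ ∈ 𝓝 p ∨ omegaMinus Ω ψ ∈ 𝓝 p) : ContDiffAt ℝ (7 : ℕ) u p :=
  hp.elim hu.smooth_plus.contDiffAt hu.smooth_minus.contDiffAt

theorem isBigO_sub_of_locallyLipschitzOn {g : ℝ × ℝ → ℝ} {s : Set (ℝ × ℝ)} (hs : s ∈ 𝓝 p)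
    (hg : LocallyLipschitzOn s g) : (fun q => g q - g p) =O[𝓝 p] fun q => q - p := by
  obtain ⟨K, t, ht, hK⟩ := hg (mem_of_mem_nhds hs)
  rw [nhdsWithin_eq_nhds.2 hs] at ht
  refine Asymptotics.IsBigO.of_bound K ?_
  filter_upwards [ht] with q hq
  exact hK.norm_sub_le hq (mem_of_mem_nhds ht)

theorem IsSolution.isBigO_pderiv_sub (hu : IsSolution Ω ψ a u f)
    (hp : omegaPlus Ω ψ ∈ 𝓝 p ∨ omegaMinus Ω ψ ∈ 𝓝 p) (m n : ℕ) (hmn : m + n = 7) :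
    (fun q => pderiv m n u q - pderiv m n u p) =O[𝓝 p] fun q => q - p :=
  hp.elim (isBigO_sub_of_locallyLipschitzOn · (hu.lip_plus m n hmn))
    (isBigO_sub_of_locallyLipschitzOn · (hu.lip_minus m n hmn))

theorem IsSolution.ellip_eventuallyEq (hu : IsSolution Ω ψ a u f) (hΩ : IsOpen Ω)
    (hψ : ContinuousOn ψ Ω) (hp : p ∈ Ω \ interface Ω ψ) : ellip a u =ᶠ[𝓝 p] f := by
  rcases omegaPlus_or_omegaMinus_mem_nhds hΩ hψ hp with h | h <;> filter_upwards [h] with q hq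
  · exact hu.pde q ⟨hq.1, fun hc => hq.2.ne' hc.2⟩
  · exact hu.pde q ⟨hq.1, fun hc => hq.2.ne hc.2⟩

theorem hasAccuracyOrder_of_solvesSystem {M : ℕ} (ha : ContDiffAt ℝ (M + 1 : ℕ) a p)
    (ha0 : a p ≠ 0) {c : ℤ → ℤ → ℕ → ℝ} (hnt : Nontriv c)
    (hc : SolvesSystem (jetAt a p) (M + 1) c) :
    HasAccuracyOrder a p M (polyCoeff (M + 1) c) (rhsCoeff (jetAt a p) (M + 1) c) (M + 1) := by
  refine ⟨fun h0 => ?_, fun u hu => ?_⟩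
  · obtain ⟨k, hk, l, hl, hkl⟩ := hnt
    exact hkl (tendsto_nhds_unique (tendsto_polyCoeff (M + 1) c k l) (h0 k hk l hl))
  · have hu' (n : ℕ) : ContDiffAt ℝ n u p := (contDiff_infty.1 hu n).contDiffAt
    exact isBigO_truncError ha ha0 (hu' _) (fun m n _ =>
      ((contDiffAt_pderiv m n (hu' _)).differentiableAt (n := (1 : ℕ)) (by simp)).isBigO_sub)
      EventuallyEq.rfl hc

end RegularPoints

/-! ### A compact sixth-order scheme for `Δv = qv` -/

section Schrodinger

/-- The weights at `k ∈ {-1, 0, 1}` of the undivided central difference of order `i ≤ 2`. -/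
noncomputable def diffWeight : ℕ → ℝ → ℝ
  | 0, k => 1 - k ^ 2
  | 1, k => k / 2
  | _, k => 3 * k ^ 2 - 2

/-- The undivided central difference of order `i` in `x` and `j` in `y`, where `i, j ≤ 2`, of a
grid function at the centre of the stencil. -/
noncomputable def gridDiff (i j : ℕ) (F : ℤ → ℤ → ℝ) : ℝ :=
  ∑ k ∈ stIdx, ∑ l ∈ stIdx, diffWeight i k * diffWeight j l * F k l

/-- The left-hand side of the compact scheme for `Δv = qv`, where `q` is given by its jet and
`d i j` are the undivided differences of `v`. The scheme is the expansion
`6h²Δv + h⁴/2 Δ²v + h⁶/60 (Δ³v + 2∂x²∂y²Δv)` of the nine-point Laplacian with `Δv` replaced by `qv`;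
`x₃`, `y₃` stand for `h³∂x³v`, `h³∂y³v`, and `x₁`, `y₁`, `b` for `h∂xv`, `h∂yv`, `h⁴Δ²v`. -/
noncomputable def schrodingerForm (q : ℕ → ℕ → ℝ) (h : ℝ) (d : ℕ → ℕ → ℝ) : ℝ :=
  let x₃ := h ^ 3 * q 1 0 * d 0 0 + h ^ 2 * q 0 0 * d 1 0 - d 1 2
  let y₃ := h ^ 3 * q 0 1 * d 0 0 + h ^ 2 * q 0 0 * d 0 1 - d 2 1
  let x₁ := d 1 0 - x₃ / 6
  let y₁ := d 0 1 - y₃ / 6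
  let b := h ^ 4 * (q 2 0 + q 0 2 + q 0 0 ^ 2) * d 0 0 + 2 * h ^ 3 * (q 1 0 * x₁ + q 0 1 * y₁)
  6 * d 2 0 + 6 * d 0 2 + d 2 2 - 6 * h ^ 2 * q 0 0 * d 0 0 - b / 2
    - (h ^ 6 * (q 4 0 + 4 * q 2 2 + q 0 4) * d 0 0
      + h ^ 5 * ((4 * q 3 0 + 8 * q 1 2) * x₁ + (4 * q 0 3 + 8 * q 2 1) * y₁)
      + h ^ 4 * ((6 * q 2 0 + 4 * q 0 2) * d 2 0 + 16 * q 1 1 * d 1 1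
        + (6 * q 0 2 + 4 * q 2 0) * d 0 2)
      + h ^ 3 * (q 1 0 * (4 * x₃ + 8 * d 1 2) + q 0 1 * (4 * y₃ + 8 * d 2 1))
      + h ^ 2 * q 0 0 * (b + 2 * d 2 2)) / 60

/-- The coefficients `C_{k,ℓ}(h)` of the compact scheme for `Δv = qv`. -/
noncomputable def schrodingerCoeff (q : ℕ → ℕ → ℝ) (k l : ℤ) (h : ℝ) : ℝ :=
  schrodingerForm q h fun i j => diffWeight i k * diffWeight j l

theorem sum_schrodingerCoeff_mul (q : ℕ → ℕ → ℝ) (h : ℝ) (F : ℤ → ℤ → ℝ) :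
    ∑ k ∈ stIdx, ∑ l ∈ stIdx, schrodingerCoeff q k l h * F k l
      = schrodingerForm q h fun i j => gridDiff i j F := by
  simp only [sum_stIdx, schrodingerCoeff, schrodingerForm, gridDiff]
  ring

variable {q V : ℕ → ℕ → ℝ}

theorem bilaplacian_jet
    (hV : ∀ i j, i + j ≤ 4 → V (i + 2) j + V i (j + 2) = leib q V i j) :
    V 4 0 + 2 * V 2 2 + V 0 4
      = (q 2 0 + q 0 2 + q 0 0 ^ 2) * V 0 0 + 2 * (q 1 0 * V 1 0 + q 0 1 * V 0 1) := by
  have h00 : V 2 0 + V 0 2 = q 0 0 * V 0 0 := by simpa [leib] using hV 0 0 (by norm_num)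
  have h20 : V 4 0 + V 2 2 = q 0 0 * V 2 0 + 2 * (q 1 0 * V 1 0) + q 2 0 * V 0 0 := by
    simpa [leib, Finset.sum_range_succ] using hV 2 0 (by norm_num)
  have h02 : V 2 2 + V 0 4 = q 0 0 * V 0 2 + 2 * (q 0 1 * V 0 1) + q 0 2 * V 0 0 := by
    simpa [leib, Finset.sum_range_succ] using hV 0 2 (by norm_num)
  linear_combination h20 + h02 + q 0 0 * h00

theorem trilaplacian_jet
    (hV : ∀ i j, i + j ≤ 4 → V (i + 2) j + V i (j + 2) = leib q V i j) :
    V 6 0 + 5 * V 4 2 + 5 * V 2 4 + V 0 6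
      = (q 4 0 + 4 * q 2 2 + q 0 4) * V 0 0
        + (4 * q 3 0 + 8 * q 1 2) * V 1 0 + (4 * q 0 3 + 8 * q 2 1) * V 0 1
        + (6 * q 2 0 + 4 * q 0 2) * V 2 0 + 16 * q 1 1 * V 1 1 + (6 * q 0 2 + 4 * q 2 0) * V 0 2
        + q 1 0 * (4 * V 3 0 + 8 * V 1 2) + q 0 1 * (4 * V 0 3 + 8 * V 2 1)
        + q 0 0 * (V 4 0 + 4 * V 2 2 + V 0 4) := by
  have hchoose : Nat.choose 4 2 = 6 := rfl
  have h40 : V 6 0 + V 4 2 = q 0 0 * V 4 0 + 4 * (q 1 0 * V 3 0) + 6 * (q 2 0 * V 2 0)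
      + 4 * (q 3 0 * V 1 0) + q 4 0 * V 0 0 := by
    simpa [leib, Finset.sum_range_succ, hchoose] using hV 4 0 le_rfl
  have h04 : V 2 4 + V 0 6 = q 0 0 * V 0 4 + 4 * (q 0 1 * V 0 3) + 6 * (q 0 2 * V 0 2)
      + 4 * (q 0 3 * V 0 1) + q 0 4 * V 0 0 := by
    simpa [leib, Finset.sum_range_succ, hchoose] using hV 0 4 le_rfl
  have h22 : V 4 2 + V 2 4 = q 0 0 * V 2 2 + 2 * (q 0 1 * V 2 1) + q 0 2 * V 2 0
      + (2 * (q 1 0 * V 1 2) + 2 * 2 * (q 1 1 * V 1 1) + 2 * (q 1 2 * V 1 0))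
      + (q 2 0 * V 0 2 + 2 * (q 2 1 * V 0 1) + q 2 2 * V 0 0) := by
    simpa [leib, Finset.sum_range_succ] using hV 2 2 le_rfl
  linear_combination h40 + 4 * h22 + h04

/- The terms of order at most six cancel. In `x₃ = h³∂x³v + h⁵e₃₀` and `x₁ = h∂xv + h⁵e₁₀` the
errors `e₃₀`, `e₁₀` come from those of the differences, and similarly for `y₃` and `y₁`. -/
theorem schrodingerForm_eq (hV : ∀ i j, i + j ≤ 4 → V (i + 2) j + V i (j + 2) = leib q V i j)
    {h r₁₀ r₀₁ r₂₀ r₁₁ r₀₂ r₁₂ r₂₁ r₂₂ e₃₀ e₀₃ e₁₀ e₀₁ : ℝ} {d : ℕ → ℕ → ℝ} (h00 : d 0 0 = V 0 0)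
    (h10 : d 1 0 = h * V 1 0 + h ^ 3 / 6 * V 3 0 + h ^ 5 * r₁₀)
    (h01 : d 0 1 = h * V 0 1 + h ^ 3 / 6 * V 0 3 + h ^ 5 * r₀₁)
    (h20 : d 2 0 = h ^ 2 * V 2 0 + h ^ 4 * r₂₀) (h11 : d 1 1 = h ^ 2 * V 1 1 + h ^ 4 * r₁₁)
    (h02 : d 0 2 = h ^ 2 * V 0 2 + h ^ 4 * r₀₂) (h12 : d 1 2 = h ^ 3 * V 1 2 + h ^ 5 * r₁₂)
    (h21 : d 2 1 = h ^ 3 * V 2 1 + h ^ 5 * r₂₁) (h22 : d 2 2 = h ^ 4 * V 2 2 + h ^ 6 * r₂₂)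
    (hL : 6 * d 2 0 + 6 * d 0 2 + d 2 2
      = 6 * h ^ 2 * (V 2 0 + V 0 2) + h ^ 4 / 2 * (V 4 0 + 2 * V 2 2 + V 0 4)
        + h ^ 6 / 60 * (V 6 0 + 5 * V 4 2 + 5 * V 2 4 + V 0 6))
    (he30 : e₃₀ = q 0 0 * (V 3 0 / 6 + h ^ 2 * r₁₀) - r₁₂)
    (he03 : e₀₃ = q 0 0 * (V 0 3 / 6 + h ^ 2 * r₀₁) - r₂₁)
    (he10 : e₁₀ = r₁₀ - e₃₀ / 6) (he01 : e₀₁ = r₀₁ - e₀₃ / 6) :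
    schrodingerForm q h d = h ^ 8 * -(q 1 0 * e₁₀ + q 0 1 * e₀₁
      + (h ^ 2 * ((4 * q 3 0 + 8 * q 1 2) * e₁₀ + (4 * q 0 3 + 8 * q 2 1) * e₀₁)
        + (6 * q 2 0 + 4 * q 0 2) * r₂₀ + 16 * q 1 1 * r₁₁ + (6 * q 0 2 + 4 * q 2 0) * r₀₂
        + q 1 0 * (4 * e₃₀ + 8 * r₁₂) + q 0 1 * (4 * e₀₃ + 8 * r₂₁)
        + q 0 0 * (2 * h ^ 2 * (q 1 0 * e₁₀ + q 0 1 * e₀₁) + 2 * r₂₂)) / 60) := by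
  have hV00 : V 2 0 + V 0 2 = q 0 0 * V 0 0 := by simpa [leib] using hV 0 0 (by norm_num)
  have hV10 : V 3 0 + V 1 2 = q 0 0 * V 1 0 + q 1 0 * V 0 0 := by
    simpa [leib, Finset.sum_range_succ] using hV 1 0 (by norm_num)
  have hV01 : V 2 1 + V 0 3 = q 0 0 * V 0 1 + q 0 1 * V 0 0 := by
    simpa [leib, Finset.sum_range_succ] using hV 0 1 (by norm_num)
  have hx₃ : h ^ 3 * q 1 0 * d 0 0 + h ^ 2 * q 0 0 * d 1 0 - d 1 2
      = h ^ 3 * V 3 0 + h ^ 5 * e₃₀ := by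
    rw [h00, h10, h12, he30]
    linear_combination -h ^ 3 * hV10
  have hy₃ : h ^ 3 * q 0 1 * d 0 0 + h ^ 2 * q 0 0 * d 0 1 - d 2 1
      = h ^ 3 * V 0 3 + h ^ 5 * e₀₃ := by
    rw [h00, h01, h21, he03]
    linear_combination -h ^ 3 * hV01
  have hx₁ : d 1 0 - (h ^ 3 * V 3 0 + h ^ 5 * e₃₀) / 6 = h * V 1 0 + h ^ 5 * e₁₀ := by
    rw [h10, he10]
    ring
  have hy₁ : d 0 1 - (h ^ 3 * V 0 3 + h ^ 5 * e₀₃) / 6 = h * V 0 1 + h ^ 5 * e₀₁ := by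
    rw [h01, he01]
    ring
  simp only [schrodingerForm, hL, hx₃, hy₃, hx₁, hy₁]
  rw [h00, h20, h11, h02, h12, h21, h22]
  linear_combination 6 * h ^ 2 * hV00 + h ^ 4 / 2 * bilaplacian_jet hV
    + h ^ 6 / 60 * trilaplacian_jet hV + h ^ 6 / 60 * q 0 0 * bilaplacian_jet hV

theorem sum_diffWeight_mul_pow_self {i : ℕ} (hi : i ≤ 2) :
    ∑ k ∈ stIdx, diffWeight i k * (k : ℝ) ^ i = i.factorial := by
  interval_cases i <;> simp only [sum_stIdx, diffWeight] <;> norm_num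

theorem sum_diffWeight_mul_pow_eq_zero {i m : ℕ} (hi : i ≤ 2) (hm : m < i + 2) (hne : m ≠ i) :
    ∑ k ∈ stIdx, diffWeight i k * (k : ℝ) ^ m = 0 := by
  interval_cases i <;> interval_cases m <;> first
    | exact absurd rfl hne
    | (simp only [sum_stIdx, diffWeight]; norm_num)

theorem gridDiff_taylorPoly (i j K : ℕ) (V : ℕ → ℕ → ℝ) (h : ℝ) :
    gridDiff i j (fun k l => taylorPoly K V (k * h) (l * h))
      = ∑ μ ∈ Lam K, h ^ (μ.1 + μ.2) * (V μ.1 μ.2 / (μ.1.factorial * μ.2.factorial)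
        * (∑ k ∈ stIdx, diffWeight i k * (k : ℝ) ^ μ.1)
        * ∑ l ∈ stIdx, diffWeight j l * (l : ℝ) ^ μ.2) := by
  simp only [gridDiff, taylorPoly, Finset.mul_sum, sum_stIdx, ← Finset.sum_add_distrib, mul_pow]
  refine Finset.sum_congr rfl fun μ _ => ?_
  ring

theorem exists_gridDiff_taylorPoly_eq {i j K : ℕ} (hi : i ≤ 2) (hj : j ≤ 2) (hK : i + j ≤ K)
    (V : ℕ → ℕ → ℝ) : ∃ r : ℝ → ℝ, Continuous r ∧ ∀ h,
      gridDiff i j (fun k l => taylorPoly K V (k * h) (l * h))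
        = h ^ (i + j) * V i j + h ^ (i + j + 2) * r h := by
  refine ⟨fun h => ∑ μ ∈ (Lam K).erase (i, j), h ^ (μ.1 + μ.2 - (i + j + 2))
    * (V μ.1 μ.2 / (μ.1.factorial * μ.2.factorial)
      * (∑ k ∈ stIdx, diffWeight i k * (k : ℝ) ^ μ.1)
      * ∑ l ∈ stIdx, diffWeight j l * (l : ℝ) ^ μ.2), by fun_prop, fun h => ?_⟩
  rw [gridDiff_taylorPoly, ← Finset.add_sum_erase _ _ (mem_Lam.2 hK : (i, j) ∈ Lam K),
    sum_diffWeight_mul_pow_self hi, sum_diffWeight_mul_pow_self hj, Finset.mul_sum]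
  refine congrArg₂ _ (by field_simp) (Finset.sum_congr rfl fun μ hμ => ?_)
  by_cases hx : μ.1 < i + 2 ∧ μ.1 ≠ i
  · simp only [sum_diffWeight_mul_pow_eq_zero hi hx.1 hx.2, mul_zero, zero_mul]
  by_cases hy : μ.2 < j + 2 ∧ μ.2 ≠ j
  · simp only [sum_diffWeight_mul_pow_eq_zero hj hy.1 hy.2, mul_zero]
  have hle : i + j + 2 ≤ μ.1 + μ.2 := by
    have := mt Prod.ext_iff.2 (Finset.ne_of_mem_erase hμ)
    simp only at this
    omega
  rw [← mul_assoc (h ^ (i + j + 2)), ← pow_add, Nat.add_sub_cancel' hle]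

theorem gridDiff_one_zero_taylorPoly_seven (V : ℕ → ℕ → ℝ) (h : ℝ) :
    gridDiff 1 0 (fun k l => taylorPoly 7 V (k * h) (l * h))
      = h * V 1 0 + h ^ 3 / 6 * V 3 0 + h ^ 5 * (V 5 0 / 120 + h ^ 2 * V 7 0 / 5040) := by
  simp only [gridDiff_taylorPoly, sum_stIdx, diffWeight, sum_Lam, Finset.sum_range_succ,
    Finset.sum_range_zero, Nat.reduceAdd, Nat.reduceSub, Nat.factorial, Int.cast_neg,
    Int.cast_one, Int.cast_zero]
  push_cast
  ring

theorem gridDiff_zero_one_taylorPoly_seven (V : ℕ → ℕ → ℝ) (h : ℝ) :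
    gridDiff 0 1 (fun k l => taylorPoly 7 V (k * h) (l * h))
      = h * V 0 1 + h ^ 3 / 6 * V 0 3 + h ^ 5 * (V 0 5 / 120 + h ^ 2 * V 0 7 / 5040) := by
  simp only [gridDiff_taylorPoly, sum_stIdx, diffWeight, sum_Lam, Finset.sum_range_succ,
    Finset.sum_range_zero, Nat.reduceAdd, Nat.reduceSub, Nat.factorial, Int.cast_neg,
    Int.cast_one, Int.cast_zero]
  push_cast
  ring

theorem gridDiff_ninePoint_taylorPoly_seven (V : ℕ → ℕ → ℝ) (h : ℝ) :
    6 * gridDiff 2 0 (fun k l => taylorPoly 7 V (k * h) (l * h))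
        + 6 * gridDiff 0 2 (fun k l => taylorPoly 7 V (k * h) (l * h))
        + gridDiff 2 2 (fun k l => taylorPoly 7 V (k * h) (l * h))
      = 6 * h ^ 2 * (V 2 0 + V 0 2) + h ^ 4 / 2 * (V 4 0 + 2 * V 2 2 + V 0 4)
        + h ^ 6 / 60 * (V 6 0 + 5 * V 4 2 + 5 * V 2 4 + V 0 6) := by
  simp only [gridDiff_taylorPoly, sum_stIdx, diffWeight, sum_Lam, Finset.sum_range_succ,
    Finset.sum_range_zero, Nat.reduceAdd, Nat.reduceSub, Nat.factorial, Int.cast_neg,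
    Int.cast_one, Int.cast_zero]
  push_cast
  ring

theorem isBigO_pow_mul (n : ℕ) {r : ℝ → ℝ} (hr : Continuous r) :
    (fun h => h ^ n * r h) =O[𝓝 0] fun h => h ^ n := by
  simpa using (Asymptotics.isBigO_refl (fun h : ℝ => h ^ n) (𝓝 0)).mul
    ((hr.tendsto 0).isBigO_one ℝ)

theorem isBigO_sum_schrodingerCoeff
    (hV : ∀ i j, i + j ≤ 4 → V (i + 2) j + V i (j + 2) = leib q V i j) :
    (fun h => ∑ k ∈ stIdx, ∑ l ∈ stIdx, schrodingerCoeff q k l h * taylorPoly 7 V (k * h) (l * h))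
      =O[𝓝 0] fun h => h ^ 8 := by
  have expand {i j : ℕ} (hi : i ≤ 2) (hj : j ≤ 2) :=
    exists_gridDiff_taylorPoly_eq hi hj (by omega : i + j ≤ 7) V
  obtain ⟨r₂₀, c₂₀, h₂₀⟩ := expand le_rfl zero_le_two
  obtain ⟨r₁₁, c₁₁, h₁₁⟩ := expand one_le_two one_le_two
  obtain ⟨r₀₂, c₀₂, h₀₂⟩ := expand zero_le_two le_rfl
  obtain ⟨r₁₂, c₁₂, h₁₂⟩ := expand one_le_two le_rfl
  obtain ⟨r₂₁, c₂₁, h₂₁⟩ := expand le_rfl one_le_two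
  obtain ⟨r₂₂, c₂₂, h₂₂⟩ := expand le_rfl le_rfl
  have h₀₀ (h : ℝ) : gridDiff 0 0 (fun k l => taylorPoly 7 V (k * h) (l * h)) = V 0 0 := by
    simp [gridDiff, sum_stIdx, diffWeight, taylorPoly_origin]
  have key (h : ℝ) := schrodingerForm_eq (h := h)
    (d := fun i j => gridDiff i j fun k l => taylorPoly 7 V (k * h) (l * h)) hV (h₀₀ h)
    (gridDiff_one_zero_taylorPoly_seven V h)
    (gridDiff_zero_one_taylorPoly_seven V h) (h₂₀ h) (h₁₁ h) (h₀₂ h) (h₁₂ h) (h₂₁ h) (h₂₂ h)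
    (gridDiff_ninePoint_taylorPoly_seven V h) rfl rfl rfl rfl
  simp only [sum_schrodingerCoeff_mul q _ fun k l => taylorPoly 7 V (k * _) (l * _), key]
  exact isBigO_pow_mul 8 (by fun_prop)

end Schrodinger

/-! ### Existence of nontrivial solutions -/

section Existence

variable {w u b : ℝ × ℝ → ℝ} {p : ℝ × ℝ} {n : ℕ}

/-- The potential `Δw / w` of the Schrödinger equation satisfied by `v = wu` when
`∇·(w²∇u) = 0`. -/
noncomputable def liouvillePotential (w : ℝ × ℝ → ℝ) : ℝ × ℝ → ℝ :=
  fun q => (dx (dx w) q + dy (dy w) q) / w q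

theorem contDiffAt_laplacian (hw : ContDiffAt ℝ (n + 2 : ℕ) w p) :
    ContDiffAt ℝ n (fun q => dx (dx w) q + dy (dy w) q) p :=
  (contDiffAt_dx (contDiffAt_dx hw)).add (contDiffAt_dy (contDiffAt_dy hw))

theorem contDiffAt_ellip (hb : ContDiffAt ℝ (n + 1 : ℕ) b p) (hu : ContDiffAt ℝ (n + 2 : ℕ) u p) :
    ContDiffAt ℝ n (ellip b u) p :=
  ((contDiffAt_dx (hb.mul (contDiffAt_dx (n := n + 1) hu))).add
    (contDiffAt_dy (hb.mul (contDiffAt_dy (n := n + 1) hu)))).neg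

theorem laplacian_mul_eventuallyEq (hw : ContDiffAt ℝ (2 : ℕ) w p) (hu : ContDiffAt ℝ (2 : ℕ) u p)
    (hp : w p ≠ 0) :
    (fun q => dx (dx fun z => w z * u z) q + dy (dy fun z => w z * u z) q)
      =ᶠ[𝓝 p] fun q => liouvillePotential w q * (w q * u q)
        + -1 / w q * ellip (fun z => w z * w z) u q := by
  have hww : ContDiffAt ℝ (1 : ℕ) (fun z => w z * w z) p :=
    (contDiffAt_of_nat_le hw one_le_two).mul (contDiffAt_of_nat_le hw one_le_two)
  filter_upwards [hw.eventually (by simp), hu.eventually (by simp),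
    hw.continuousAt.eventually_ne hp, ellip_eventuallyEq hww hu] with q hwq huq hq0 he
  have hwd : DifferentiableAt ℝ w q := hwq.differentiableAt (by simp)
  have hxx : dx (dx fun z => w z * u z) q
      = w q * dx (dx u) q + 2 * (dx w q * dx u q) + dx (dx w) q * u q := by
    simpa [leib, Finset.sum_range_succ, jetAt, pderiv] using pderiv_mul 2 0 hwq huq
  have hyy : dy (dy fun z => w z * u z) q
      = w q * dy (dy u) q + 2 * (dy w q * dy u q) + dy (dy w) q * u q := by
    simpa [leib, Finset.sum_range_succ, jetAt, pderiv] using pderiv_mul 0 2 hwq huq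
  rw [he, dx_mul hwd hwd, dy_mul hwd hwd, hxx, hyy, liouvillePotential]
  field_simp
  ring

theorem jetAt_mul_add_eq_leib {K : ℕ} (hw : ContDiffAt ℝ (K + 2 : ℕ) w p)
    (hu : ContDiffAt ℝ (K + 2 : ℕ) u p) (hp : w p ≠ 0)
    (he : ∀ i j, i + j ≤ K → pderiv i j (ellip (fun z => w z * w z) u) p = 0)
    (i j : ℕ) (hij : i + j ≤ K) :
    jetAt (fun z => w z * u z) p (i + 2) j + jetAt (fun z => w z * u z) p i (j + 2)
      = leib (jetAt (liouvillePotential w) p) (jetAt (fun z => w z * u z) p) i j := by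
  have le {g : ℝ × ℝ → ℝ} {m : ℕ} (hg : ContDiffAt ℝ (K + 2 : ℕ) g p) (hm : m ≤ i + j + 2) :
    ContDiffAt ℝ m g p := contDiffAt_of_nat_le hg (by omega)
  have hV : ContDiffAt ℝ (i + j : ℕ) (liouvillePotential w) p :=
    (contDiffAt_laplacian (le hw le_rfl)).div (le hw (by omega)) hp
  have hinv : ContDiffAt ℝ (i + j : ℕ) (fun q => -1 / w q) p :=
    contDiffAt_const.div (le hw (by omega)) hp
  have hE : ContDiffAt ℝ (i + j : ℕ) (ellip (fun z => w z * w z) u) p :=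
    contDiffAt_ellip ((le hw (by omega)).mul (le hw (by omega))) (le hu le_rfl)
  have hv : ContDiffAt ℝ (i + j : ℕ) (fun z => w z * u z) p :=
    (le hw (by omega)).mul (le hu (by omega))
  have hEzero : leib (jetAt (fun q => -1 / w q) p) (jetAt (ellip (fun z => w z * w z) u) p) i j
      = leib (jetAt (fun q => -1 / w q) p) (fun _ _ => 0) i j :=
    leib_congr (fun _ _ _ => rfl) fun m n hmn => he m n (by omega)
  rw [← jetAt_laplacian (le (hw.mul hu) le_rfl), jetAt,
    (pderiv_congr i j (laplacian_mul_eventuallyEq (le hw (by omega)) (le hu (by omega))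
      hp)).eq_of_nhds, pderiv_add i j (hV.mul hv) (hinv.mul hE), pderiv_mul i j hV hv,
    pderiv_mul i j hinv hE, hEzero]
  simp [leib]

theorem contDiff_schrodingerCoeff (q : ℕ → ℕ → ℝ) (k l : ℤ) :
    ContDiff ℝ n (schrodingerCoeff q k l) := by
  unfold schrodingerCoeff schrodingerForm
  fun_prop

theorem isBigO_stencil_sum_mul {L : Filter ℝ} {C T : ℤ → ℤ → ℝ → ℝ}
    (hC : ∀ k l, C k l =O[L] fun _ => (1 : ℝ)) (hT : ∀ k l, T k l =O[L] fun h => h ^ n) :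
    (fun h => ∑ k ∈ stIdx, ∑ l ∈ stIdx, C k l h * T k l h) =O[L] fun h => h ^ n :=
  Asymptotics.IsBigO.fun_sum fun k _ => Asymptotics.IsBigO.fun_sum fun l _ => by
    simpa only [one_mul] using (hC k l).mul (hT k l)

theorem isBigO_sum_schrodingerCoeff_mul (hw : ContDiffAt ℝ (8 : ℕ) w p)
    (hu : ContDiffAt ℝ (8 : ℕ) u p) (hp : w p ≠ 0)
    (he : ∀ i j, i + j ≤ 4 → pderiv i j (ellip (fun z => w z * w z) u) p = 0) :
    (fun h => ∑ k ∈ stIdx, ∑ l ∈ stIdx, schrodingerCoeff (jetAt (liouvillePotential w) p) k l h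
      * (w (stPt p h k l) * u (stPt p h k l))) =O[𝓝 0] fun h => h ^ 8 := by
  have hpoly := isBigO_sum_schrodingerCoeff (jetAt_mul_add_eq_leib (K := 4)
    (contDiffAt_of_nat_le hw (by norm_num)) (contDiffAt_of_nat_le hu (by norm_num)) hp he)
  have hrem := isBigO_stencil_sum_mul
    (fun k l => ((contDiff_schrodingerCoeff (n := 0) (jetAt (liouvillePotential w) p) k
      l).continuous.tendsto 0).isBigO_one ℝ)
    (fun k l => isBigO_sub_taylorPoly_of_contDiffAt k l 7 (hw.mul hu))
  refine (hrem.add hpoly).congr_left fun h => ?_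
  simp only [← Finset.sum_add_distrib, ← mul_add, sub_add_cancel]
  rfl

theorem exists_isBigO_polynomial_sub {D : ℝ → ℝ} (hD : ContDiffAt ℝ (n + 1 : ℕ) D 0) :
    ∃ c : ℕ → ℝ, c 0 = D 0 ∧
      (fun h => ∑ i ∈ Finset.range (n + 1), c i * h ^ i - D h) =O[𝓝[>] 0] fun h => h ^ (n + 1) := by
  obtain ⟨s, hs, hDs⟩ := hD.contDiffOn le_rfl (by simp)
  obtain ⟨ε, hε, hεs⟩ := Metric.nhds_basis_closedBall.mem_iff.1 hs
  have hsub : Icc 0 ε ⊆ s := by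
    refine Subset.trans (fun t ht => ?_) hεs
    rw [mem_closedBall_zero_iff, Real.norm_of_nonneg ht.1]
    exact ht.2
  obtain ⟨B, hB⟩ := exists_taylor_mean_remainder_bound hε.le
    (show ContDiffOn ℝ (n + 1) D (Icc 0 ε) from hDs.mono hsub)
  refine ⟨fun i => (i.factorial : ℝ)⁻¹ * iteratedDerivWithin i D (Icc 0 ε) 0, by simp, ?_⟩
  refine Asymptotics.IsBigO.of_bound B ?_
  filter_upwards [Ioc_mem_nhdsGT hε] with h hh
  have heval : ∑ i ∈ Finset.range (n + 1), (i.factorial : ℝ)⁻¹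
      * iteratedDerivWithin i D (Icc 0 ε) 0 * h ^ i = taylorWithinEval D n (Icc 0 ε) 0 h := by
    rw [taylor_within_apply]
    refine Finset.sum_congr rfl fun i _ => ?_
    rw [sub_zero, smul_eq_mul, mul_right_comm]
  rw [heval, norm_sub_rev, Real.norm_of_nonneg (pow_nonneg hh.1.le _)]
  simpa only [sub_zero] using hB h (Ioc_subset_Icc_self hh)

theorem exists_nontriv_solvesSystem_of_contDiffAt {α : ℕ → ℕ → ℝ} {M : ℕ} (hα : α 0 0 ≠ 0)
    {D : ℤ → ℤ → ℝ → ℝ} (hD : ∀ k l, ContDiffAt ℝ (M + 2 : ℕ) (D k l) 0)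
    (hD0 : ∃ k ∈ stIdx, ∃ l ∈ stIdx, D k l 0 ≠ 0)
    (h : ∀ m n, m ≤ 1 → m + n ≤ M + 1 → (fun h => ∑ k ∈ stIdx, ∑ l ∈ stIdx,
      D k l h * taylorPoly (M + 1) (solJet α (unitJet m n) 0) (k * h) (l * h))
        =O[𝓝[>] 0] fun h => h ^ (M + 2)) :
    ∃ c, Nontriv c ∧ SolvesSystem α M c := by
  choose c hc0 hc using fun k l => exists_isBigO_polynomial_sub (n := M + 1) (hD k l)
  refine ⟨c, by simpa only [Nontriv, hc0] using hD0, fun μ hμ => ?_⟩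
  obtain ⟨hμM, hμ1⟩ := mem_LamV1.1 hμ
  have htaylor (k l : ℤ) : Continuous fun h : ℝ =>
      taylorPoly (M + 1) (solJet α (unitJet μ.1 μ.2) 0) (k * h) (l * h) := by
    unfold taylorPoly
    fun_prop
  have hrem := isBigO_stencil_sum_mul
    (fun k l => (((htaylor k l).tendsto 0).mono_left nhdsWithin_le_nhds).isBigO_one ℝ) hc
  refine (hrem.add (h μ.1 μ.2 hμ1 hμM)).congr_left fun h => ?_
  simp only [← Finset.sum_add_distrib, GV_eq_taylorPoly hα hμ1 hμM, polyCoeff]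
  refine Finset.sum_congr rfl fun k _ => Finset.sum_congr rfl fun l _ => ?_
  ring

/- With `w = √a` and `v = wu`, the scheme for `Δv = qv` multiplied by `w` is one for
`∇·(a∇u) = 0`; here `a` may be replaced by its Taylor polynomial. -/
theorem exists_nontriv_solvesSystem {α : ℕ → ℕ → ℝ} (hα : 0 < α 0 0) :
    ∃ c, Nontriv c ∧ SolvesSystem α 6 c := by
  let b : ℝ × ℝ → ℝ := polyAt 5 α 0
  let w : ℝ × ℝ → ℝ := fun z => √(b z)
  let q : ℕ → ℕ → ℝ := jetAt (liouvillePotential w) 0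
  have hjet (i j : ℕ) (hij : i + j ≤ 5) : jetAt b 0 i j = α i j := jetAt_polyAt hij α 0
  have hb (n : ℕ) : ContDiffAt ℝ n b 0 := (contDiff_polyAt 5 α 0).contDiffAt
  have hb0 : 0 < b 0 := hα.trans_eq (hjet 0 0 (by norm_num)).symm
  have hw : ContDiffAt ℝ (8 : ℕ) w 0 := (hb 8).sqrt hb0.ne'
  have hw0 : w 0 ≠ 0 := (Real.sqrt_pos.2 hb0).ne'
  have hww : (fun z => w z * w z) =ᶠ[𝓝 0] b := by
    filter_upwards [(hb 0).continuousAt.eventually (lt_mem_nhds hb0)] with z hz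
    exact Real.mul_self_sqrt hz.le
  have hst (k l : ℤ) : stPt 0 0 k l = 0 := by simp [stPt]
  have hray (k l : ℤ) : ContDiffAt ℝ (8 : ℕ) (fun h => w (stPt 0 h k l)) 0 :=
    ContDiffAt.comp (g := w) 0 ((hst k l).symm ▸ hw) (by unfold stPt; fun_prop)
  refine exists_nontriv_solvesSystem_of_contDiffAt hα.ne'
    (D := fun k l h => schrodingerCoeff q k l h * w (stPt 0 h k l))
    (fun k l => (contDiff_schrodingerCoeff q k l).contDiffAt.mul (hray k l))
    ⟨0, by decide, 0, by decide, ?_⟩ fun m n _ _ => ?_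
  · rw [hst]
    refine mul_ne_zero ?_ hw0
    norm_num [schrodingerCoeff, schrodingerForm, diffWeight]
  · have hsol := isBigO_sum_schrodingerCoeff_mul (u := polyAt 7 (solJet α (unitJet m n) 0) 0) hw
      (contDiff_polyAt _ _ _).contDiffAt hw0 fun i j hij => by
        rw [(pderiv_congr i j (ellip_congr hww EventuallyEq.rfl)).eq_of_nhds]
        exact pderiv_ellip_polyAt_solJet hα.ne' (hb _) (fun _ _ _ => hjet _ _ (by omega))
          (by omega) _ 0
    refine (hsol.mono nhdsWithin_le_nhds).congr_left fun h => ?_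
    simp only [polyAt, stPt, add_sub_cancel_left, mul_assoc, q]

end Existence

end CompactFD

theorem theorem2p1_general {Ω : Set (ℝ × ℝ)} (hΩ : IsOpen Ω) {ψ a : ℝ × ℝ → ℝ}
    (hψ : ContinuousOn ψ Ω)
    (ha : IsCoefficient Ω ψ a)
    {p : ℝ × ℝ} (hp : p ∈ Ω \ interface Ω ψ) :
    (∀ᶠ h in 𝓝[>] (0 : ℝ), IsRegularPoint ψ p h ∧
      ∀ k ∈ stIdx, ∀ l ∈ stIdx, stPt p h k l ∈ Ω) ∧
    (∃ c, Nontriv c ∧ SolvesSystem (jetAt a p) 6 c) ∧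
    (∀ c, Nontriv c → SolvesSystem (jetAt a p) 6 c →
      ∃ lam : ℝ, lam ≠ 0 ∧ ∀ u f : ℝ × ℝ → ℝ, IsSolution Ω ψ a u f →
        Tendsto (fun h : ℝ => stencilOp (polyCoeff 6 c) p u h / h ^ 2) (𝓝[>] 0)
          (𝓝 (lam * f p)) ∧
        truncError 5 (polyCoeff 6 c) (rhsCoeff (jetAt a p) 6 c) p u f
          =O[𝓝[>] 0] fun h : ℝ => h ^ 8) ∧
    IsGreatest {q : ℕ | ∃ (N : ℕ) (C : ℤ → ℤ → ℝ → ℝ) (F : ℕ → ℕ → ℝ → ℝ),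
      ContDiffAt ℝ ((N + 1 : ℕ) : WithTop ℕ∞) a p ∧ HasAccuracyOrder a p N C F q} 6 := by
  have hnhds := omegaPlus_or_omegaMinus_mem_nhds hΩ hψ hp
  have ha6 := ha.contDiffAt hnhds
  have ha0 := ha.pos hnhds
  refine ⟨?_, exists_nontriv_solvesSystem (α := jetAt a p) ha0, ?_, ?_, ?_⟩
  · exact (eventually_isRegularPoint hnhds).and (eventually_stPt_mem (hΩ.mem_nhds hp.1))
  · intro c hnt hc
    refine ⟨leadRhs (jetAt a p) c,
      leadRhs_ne_zero (α := jetAt a p) ha0.ne' (by norm_num) hc hnt, fun u f hu => ?_⟩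
    have herr := isBigO_truncError (M := 5) ha6 ha0.ne' (hu.contDiffAt hnhds)
      (hu.isBigO_pderiv_sub hnhds) (hu.ellip_eventuallyEq hΩ hψ hp) hc
    exact ⟨tendsto_stencilOp_div (α := jetAt a p) ha0.ne' herr, herr⟩
  · obtain ⟨c, hnt, hc⟩ := exists_nontriv_solvesSystem (α := jetAt a p) ha0
    exact ⟨5, polyCoeff 6 c, rhsCoeff (jetAt a p) 6 c, ha6,
      hasAccuracyOrder_of_solvesSystem (M := 5) ha6 ha0.ne' hnt hc⟩
  · rintro q ⟨N, C, F, haN, h⟩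
    exact h.le_six ha0.ne' haN

theorem theorem2p1 (l₁ l₂ l₃ l₄ : ℝ) (ψ a : ℝ × ℝ → ℝ)
    (hψ : ContinuousOn ψ (rect l₁ l₂ l₃ l₄))
    (ha : IsCoefficient (rect l₁ l₂ l₃ l₄) ψ a)
    (p : ℝ × ℝ) (hp : p ∈ rect l₁ l₂ l₃ l₄ \ interface (rect l₁ l₂ l₃ l₄) ψ) :
    -- for all small `h` the stencil centred at `p` lies in `Ω` and `p` is a regular point
    (∀ᶠ h in 𝓝[>] (0 : ℝ), IsRegularPoint ψ p h ∧
      ∀ k ∈ stIdx, ∀ l ∈ stIdx, stPt p h k l ∈ rect l₁ l₂ l₃ l₄) ∧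
    -- the order-matching system with `M = 6` has a nontrivial solution
    (∃ c, Nontriv c ∧ SolvesSystem (jetAt a p) 6 c) ∧
    -- every nontrivial solution gives a sixth-order consistent scheme
    (∀ c, Nontriv c → SolvesSystem (jetAt a p) 6 c →
      ∃ lam : ℝ, lam ≠ 0 ∧ ∀ u f : ℝ × ℝ → ℝ, IsSolution (rect l₁ l₂ l₃ l₄) ψ a u f →
        Tendsto (fun h : ℝ => stencilOp (polyCoeff 6 c) p u h / h ^ 2) (𝓝[>] 0)
          (𝓝 (lam * f p)) ∧
        truncError 5 (polyCoeff 6 c) (rhsCoeff (jetAt a p) 6 c) p u f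
          =O[𝓝[>] 0] fun h : ℝ => h ^ 8) ∧
    -- six is the maximum accuracy order of a compact nine-point scheme at `p`
    IsGreatest {q : ℕ | ∃ (N : ℕ) (C : ℤ → ℤ → ℝ → ℝ) (F : ℕ → ℕ → ℝ → ℝ),
      ContDiffAt ℝ ((N + 1 : ℕ) : WithTop ℕ∞) a p ∧ HasAccuracyOrder a p N C F q} 6 :=
  theorem2p1_general (isOpen_rect l₁ l₂ l₃ l₄) hψ ha hp
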